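/- **Setting.** There are $K$ arms with unknown parameters $\theta_1^c,\dots,\theta_K^c\in\mathbb R^d$. Pulling arm $a$ under a context $s\in\mathbb R^d$ gives a random reward $R(s,a)$ with mean $r(s,a)=s^\top\theta_a^c$. For all contexts $s\in\mathbb R^d$ with $s\ge 0$ (coordinatewise) and $\|s\|_2\le 1$, and all arms $a$, $R(s,a)\in[0,1]$. All contexts $s_1,\dots,s_T$ are of this kind; they may be fixed, random, or chosen adaptively on the basis of the past. **Algorithm.** Let $\alpha\in[0,1)$, $n=\lceil 1/(1-\alpha)\rceil$, $\delta>0$, and $\nu_t=\tfrac34\sqrt{d\ln(4t/\delta)}$. In round $t=1,\dots,T$ put, for each arm $a$, $$V_{a}=I_d+\sum_{\tau<t,\;a_\tau=a}s_\tau s_\tau^\top,\qquad \theta_{a}=V_{a}^{-1}\sum_{\tau<t,\;a_\tau=a}s_\tau R(s_\tau,a_\tau).$$ Given the past and $s_t$, draw independent samples $r_{a,1},\dots,r_{a,n}\sim\mathcal N\big(s_t^\top\theta_a,\;\nu_t^2\,s_t^\top V_a^{-1}s_t\big)$ for every arm $a$. Pull an arm $a_t$ that maximizes $C(r_{a,1},\dots,r_{a,n})$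 over $a$ (ties broken arbitrarily), and receive $R(s_t,a_t)$. Here $C$ is either of the following two estimators of CVaR at level $\alpha$: the Monte Carlo estimator $\max_x\{x-\frac1{n(1-\alpha)}\sum_{i=1}^n(x-r_{a,i})^+\}$, or the modified estimator, which is the smallest sample if $\frac1{1-\alpha}$ is an integer and the second smallest sample otherwise. **Theorem.** Let $T\ge1$ and $\mathrm{Regret}(T)=\sum_{t=1}^T\big(\max_a r(s_t,a)-r(s_t,a_t)\big)$. 1. For every $\delta\in(0,1)$, the algorithm run with parameter $\delta$ satisfies, with probability at least $1-\delta$, $$\mathrm{Regret}(T)\le\frac{3(4\sqrt\pi e)^{\frac{2-\alpha}{1-\alpha}}}{2}\sqrt{d\ln\frac{4T}{\delta}\,\ln\frac{2T^2}{1-\alpha}}\left(15\sqrt{dKT\ln T}+6\sqrt{2T\ln\frac2\delta}\right).$$ 2. The algorithm run with parameter $\delta=1/T^2$ satisfies $$\mathbb E[\mathrm{Regret}(T)]\le\frac{3(4\sqrt\pi e)^{\frac{2-\alpha}{1-\alpha}}}{2}\sqrt{d\ln(4T^2)\,\ln\frac{2T^2}{1-\alpha}}\left(15\sqrt{dKT\ln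 T}+6\sqrt{2T\ln(2T^2)}\right).$$ -/

import Mathlib

open MeasureTheory ProbabilityTheory
open scoped Matrix

namespace BRCMAB

noncomputable section

/-- The contexts allowed by the model: vectors with non-negative coordinates and
Euclidean norm at most `1`. -/
def contextSpace (d : ℕ) : Set (EuclideanSpace ℝ (Fin d)) :=
  {s | (∀ i, 0 ≤ s i) ∧ ‖s‖ ≤ 1}

/-- The expected reward `r(s, a) = sᵀ θ_a` of arm `a` under context `s`. -/
def expReward {d K : ℕ} (θ : Fin K → EuclideanSpace ℝ (Fin d))
    (s : EuclideanSpace ℝ (Fin d)) (a : Fin K) : ℝ :=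
  s.ofLp ⬝ᵥ (θ a).ofLp

/-- `Q a s` is the law of the random reward `R(s, a)`. For every context `s` and every arm `a`
the reward lies in `[0, 1]` and has expectation `sᵀ θ_a`. -/
structure BoundedLinearRewards {d K : ℕ} (θ : Fin K → EuclideanSpace ℝ (Fin d))
    (Q : Fin K → Kernel (EuclideanSpace ℝ (Fin d)) ℝ) : Prop where
  mem_unit : ∀ s ∈ contextSpace d, ∀ a, ∀ᵐ x ∂(Q a s), x ∈ Set.Icc (0 : ℝ) 1
  mean_eq : ∀ s ∈ contextSpace d, ∀ a, ∫ x, x ∂(Q a s) = expReward θ s a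

/-! ### CVaR estimators -/

/-- The number `n = ⌈1 / (1 - α)⌉` of samples drawn for each arm in each round. -/
def sampleSize (α : ℝ) : ℕ := ⌈1 / (1 - α)⌉₊

/-- The `k`-th smallest of the values `r i` (for `1 ≤ k ≤ n`): the smallest `x` such that at
least `k` of the values are `≤ x`. -/
def orderStat {n : ℕ} (k : ℕ) (r : Fin n → ℝ) : ℝ :=
  sInf {x : ℝ | k ≤ (Finset.univ.filter fun i => r i ≤ x).card}

/-- The Monte Carlo estimator of CVaR:
`max_x { x - (1 / (n (1 - α))) ∑ i, (x - r i)⁺ }`. -/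
def mcCVaR (α : ℝ) {n : ℕ} (r : Fin n → ℝ) : ℝ :=
  ⨆ x : ℝ, (x - 1 / ((n : ℝ) * (1 - α)) * ∑ i, max (x - r i) 0)

open Classical in
/-- The modified estimator of CVaR: the smallest sample if `1 / (1 - α)` is an integer, the
second smallest one otherwise. -/
def modCVaR (α : ℝ) {n : ℕ} (r : Fin n → ℝ) : ℝ :=
  if ∃ m : ℤ, 1 / (1 - α) = (m : ℝ) then orderStat 1 r else orderStat 2 r

/-! ### Posterior parameters

`s τ`, `a τ`, `R τ` are the context, the pulled arm and the received reward of round `τ ≥ 1`.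
The parameters with index `t` are those in force when round `t` begins; they use the rounds
`1, …, t - 1`. -/

/-- `V_b = I + ∑ s_τ s_τᵀ`, over the rounds `1 ≤ τ < t` in which arm `b` was pulled. -/
def precision {d K : ℕ} (s : ℕ → EuclideanSpace ℝ (Fin d)) (a : ℕ → Fin K)
    (t : ℕ) (b : Fin K) : Matrix (Fin d) (Fin d) ℝ :=
  1 + ∑ τ ∈ (Finset.Ico 1 t).filter (fun τ => a τ = b),
    Matrix.vecMulVec (s τ).ofLp (s τ).ofLp

/-- `θ_b = V_b⁻¹ ∑ R_τ s_τ`, over the rounds `1 ≤ τ < t` in which arm `b` was pulled. -/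
def estimate {d K : ℕ} (s : ℕ → EuclideanSpace ℝ (Fin d)) (a : ℕ → Fin K) (R : ℕ → ℝ)
    (t : ℕ) (b : Fin K) : Fin d → ℝ :=
  (precision s a t b)⁻¹ *ᵥ
    ∑ τ ∈ (Finset.Ico 1 t).filter (fun τ => a τ = b), R τ • (s τ).ofLp

/-- The inflated sampling scale `ν_t = (3/4) √(d ln (4 t / δ))`. -/
def samplingScale (d : ℕ) (δ : ℝ) (t : ℕ) : ℝ :=
  3 / 4 * √((d : ℝ) * Real.log (4 * (t : ℝ) / δ))

/-- The law `N(s_tᵀ θ_b, ν_t² s_tᵀ V_b⁻¹ s_t)` from which the samples for arm `b` are drawn in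
round `t`. -/
def samplingLaw {d K : ℕ} (δ : ℝ) (s : ℕ → EuclideanSpace ℝ (Fin d)) (a : ℕ → Fin K)
    (R : ℕ → ℝ) (t : ℕ) (b : Fin K) : Measure ℝ :=
  gaussianReal ((s t).ofLp ⬝ᵥ estimate s a R t b)
    (Real.toNNReal (samplingScale d δ t ^ 2 *
      ((s t).ofLp ⬝ᵥ ((precision s a t b)⁻¹ *ᵥ (s t).ofLp))))

/-! ### The algorithm -/

/-- `κ` is the conditional law of `X` given the σ-algebra `𝓖`. -/
def HasCondLaw {Ω β : Type*} [MeasurableSpace Ω] [MeasurableSpace β] (P : Measure Ω)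
    (𝓖 : MeasurableSpace Ω) (X : Ω → β) (κ : Ω → Measure β) : Prop :=
  ∀ B : Set β, MeasurableSet B → P⟦X ⁻¹' B | 𝓖⟧ =ᵐ[P] fun ω => (κ ω).real B

/-- The processes `s, r, a, R` on `(Ω, P)` are a run over the rounds `1, …, T` of posterior
sampling with parameter `δ` and CVaR estimator `C`, on the bandit with reward laws `Q`.
`pre t` is the information available once the context of round `t` has been revealed, `post t`
that available once the arm of round `t` has been chosen. Contexts may be deterministic, random,
or chosen adaptively; ties in the choice of the arm may be broken in any way. -/
structure IsRun {Ω : Type*} [mΩ : MeasurableSpace Ω] (P : Measure Ω) {d K n : ℕ} (T : ℕ)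
    (δ : ℝ) (C : (Fin n → ℝ) → ℝ) (Q : Fin K → Kernel (EuclideanSpace ℝ (Fin d)) ℝ)
    (pre post : Filtration ℕ mΩ)
    (s : ℕ → Ω → EuclideanSpace ℝ (Fin d)) (r : ℕ → Ω → Fin K → Fin n → ℝ)
    (a : ℕ → Ω → Fin K) (R : ℕ → Ω → ℝ) : Prop where
  pre_le_post : ∀ t, pre t ≤ post t
  post_le_pre : ∀ t, post t ≤ pre (t + 1)
  /-- the context of round `t` -/
  context_meas : ∀ t ∈ Finset.Icc 1 T, Measurable[pre t] (s t)
  context_mem : ∀ t ∈ Finset.Icc 1 T, ∀ᵐ ω ∂P, s t ω ∈ contextSpace d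
  /-- given the past and the context, the samples `r t · b i` are independent, with law
  `N(s_tᵀ θ_b, ν_t² s_tᵀ V_b⁻¹ s_t)` for arm `b` -/
  sample_meas : ∀ t ∈ Finset.Icc 1 T, Measurable[post t] (r t)
  sample_law : ∀ t ∈ Finset.Icc 1 T, HasCondLaw P (pre t) (r t) fun ω =>
    Measure.pi fun b => Measure.pi fun _ : Fin n =>
      samplingLaw δ (fun τ => s τ ω) (fun τ => a τ ω) (fun τ => R τ ω) t b
  /-- an arm with the largest CVaR estimate is pulled -/
  arm_meas : ∀ t ∈ Finset.Icc 1 T, Measurable[post t] (a t)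
  arm_max : ∀ t ∈ Finset.Icc 1 T, ∀ᵐ ω ∂P, ∀ b, C (r t ω b) ≤ C (r t ω (a t ω))
  /-- the reward `R(s_t, a_t)` is received -/
  reward_meas : ∀ t ∈ Finset.Icc 1 T, Measurable[pre (t + 1)] (R t)
  reward_law : ∀ t ∈ Finset.Icc 1 T,
    HasCondLaw P (post t) (R t) fun ω => Q (a t ω) (s t ω)

/-- The conventional regret `∑_{t=1}^T (max_b r(s_t, b) - r(s_t, a_t))`. -/
def regret {Ω : Type*} {d K : ℕ} (T : ℕ) (θ : Fin K → EuclideanSpace ℝ (Fin d))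
    (s : ℕ → Ω → EuclideanSpace ℝ (Fin d)) (a : ℕ → Ω → Fin K) (ω : Ω) : ℝ :=
  ∑ t ∈ Finset.Icc 1 T, ((⨆ b, expReward θ (s t ω) b) - expReward θ (s t ω) (a t ω))

end

end BRCMAB

/-!
The regret of posterior sampling is controlled by two facts about the posterior deviation
`√w_b = √(sᵀ V_b⁻¹ s)` of the arms.

*Concentration of the rewards.* For each arm, `errPotential`, which is
`det(V_b)^(-1/2) exp(2 ‖θ̂_b - θ_b‖²)` with the norm of `V_b`, is a supermartingale: its change in a
pull is a Gaussian mixture of the exponentials in Hoeffding's lemma, with average at most `1`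
(`lintegral_errFactor_le`). By Ville's inequality (`measure_exists_le_prod_le`) it stays bounded for
all the rounds, and then every true reward is within `4 / 3` sampling standard deviations of its
prediction (`abs_prediction_sub_le`). Since `θ_b` lies in the unit ball, the starting value of the
potential is at most `e²`.

*Optimism of the samples.* A Gaussian exceeds its mean by `4 / 3` standard deviations with
probability at least `1 / (4 √π e)` (`le_gaussianReal_Ici`). An estimator of CVaR lies between the
extreme samples, so that the estimate of an optimal arm exceeds its true reward with conditional
probability at least `(4 √π e)^(-n)`, and `n ≤ (2 - α) / (1 - α)`. When this happens and all the
samples are within `g` standard deviations of their means, the pulled arm is unsaturated: its gap is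
at most a multiple `W` of its deviation. In general the pulled arm competes with the unsaturated arm
of smallest deviation. So the regret of a round is at most a multiple of the deviation of the pulled
arm, plus a `surplus` of nonpositive conditional mean (`round_regret_le`, `integral_surplus_le`). An
Azuma–Hoeffding bound controls the sum of the surpluses (`IsRun.measure_sum_surplus_ge_le`), and the
elliptical potential inequality the sum of the deviations (`sum_postVar_le`).

Conditional expectations enter only through the freezing lemma `HasCondLaw.lintegral_eq`, which
needs no regularity of the probability space. The constants leave room: either the claimed bound
exceeds `T` and is trivial, or `T` is so large that half of it holds
(`IsRun.measure_half_bound_lt_le`). The bound in expectation follows from this by integration.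
-/

namespace BRCMAB

/-! ### Freezing, and Ville's inequality -/

/-- The case of events of `HasCondLaw.lintegral_eq`, by Dynkin's π-λ theorem from rectangles. -/
theorem HasCondLaw.measure_preimage_eq {Ω α β : Type*} {𝓖 : MeasurableSpace Ω}
    [mΩ : MeasurableSpace Ω] [MeasurableSpace α] [MeasurableSpace β] {P : Measure Ω} [IsProbabilityMeasure P]
    (h𝓖 : 𝓖 ≤ mΩ) {X : Ω → α} {Y : Ω → β} {κ : Ω → Measure β}
    [∀ ω, IsProbabilityMeasure (κ ω)] (h : HasCondLaw P 𝓖 Y κ) (hX : Measurable[𝓖] X)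
    (hY : Measurable Y) {A : Set (α × β)} (hA : MeasurableSet A) :
    AEMeasurable (fun ω => κ ω (Prod.mk (X ω) ⁻¹' A)) P ∧
      P ((fun ω => (X ω, Y ω)) ⁻¹' A) = ∫⁻ ω, κ ω (Prod.mk (X ω) ⁻¹' A) ∂P := by
  have hXm : Measurable X := hX.mono h𝓖 le_rfl
  have hXY : Measurable fun ω => (X ω, Y ω) := hXm.prodMk hY
  have hsec : ∀ (s : Set (α × β)), MeasurableSet s → ∀ ω, MeasurableSet (Prod.mk (X ω) ⁻¹' s) :=
    fun s hs ω => measurable_prodMk_left hs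
  induction A, hA using MeasurableSpace.induction_on_inter generateFrom_prod.symm
    isPiSystem_prod with
  | empty => simp
  | basic s hs =>
    obtain ⟨A, hA, B, hB, rfl⟩ := hs
    simp only [Set.mem_ofPred_eq] at hA hB
    have hκ : ∀ ω, κ ω (Prod.mk (X ω) ⁻¹' A ×ˢ B) =
        (X ⁻¹' A).indicator (fun ω => κ ω B) ω := by
      intro ω
      by_cases hω : X ω ∈ A
      · rw [Set.indicator_of_mem (by exact hω)]
        congr 1
        ext y; simp [hω]
      · rw [Set.indicator_of_notMem (by exact hω)]
        convert measure_empty (μ := κ ω)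
        ext y; simp [hω]
    have hB' := h B hB
    have hae : AEMeasurable (fun ω => κ ω B) P := by
      have h1 : AEMeasurable (fun ω => (κ ω).real B) P :=
        ⟨_, (stronglyMeasurable_condExp.mono h𝓖).measurable, hB'.symm⟩
      refine h1.ennreal_ofReal.congr (Filter.Eventually.of_forall fun ω => ?_)
      simp [Measure.real]
    simp only [hκ]
    refine ⟨hae.indicator (hXm hA), ?_⟩
    rw [lintegral_indicator (hXm hA)]
    have h2 : ∫ ω in X ⁻¹' A, (κ ω).real B ∂P = P.real (X ⁻¹' A ∩ Y ⁻¹' B) := by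
      rw [← setIntegral_congr_ae (hXm hA) (f := P⟦Y ⁻¹' B | 𝓖⟧)
        (hB'.mono fun ω hω _ => hω),
        setIntegral_condExp h𝓖 ((integrable_const (1 : ℝ)).indicator (hY hB)) (hX hA),
        setIntegral_indicator (hY hB)]
      simp
    have h3 : ∫⁻ ω in X ⁻¹' A, κ ω B ∂P = ENNReal.ofReal (∫ ω in X ⁻¹' A, (κ ω).real B ∂P) := by
      rw [ofReal_integral_eq_lintegral_ofReal]
      · refine lintegral_congr fun ω => ?_
        simp [Measure.real]
      · refine (Integrable.congr ?_ hB').integrableOn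
        exact integrable_condExp
      · exact Filter.Eventually.of_forall fun ω => measureReal_nonneg
    rw [h3, h2]
    simp only [Measure.real, ne_eq, measure_ne_top, not_false_eq_true, ENNReal.ofReal_toReal]
    congr 1
  | compl s hs ih =>
    have hκ : ∀ ω, κ ω (Prod.mk (X ω) ⁻¹' sᶜ) = 1 - κ ω (Prod.mk (X ω) ⁻¹' s) := by
      intro ω
      rw [Set.preimage_compl, measure_compl (hsec s hs ω) (measure_ne_top _ _), measure_univ]
    simp only [hκ]
    refine ⟨aemeasurable_const.sub ih.1, ?_⟩
    have hle : ∀ ω, κ ω (Prod.mk (X ω) ⁻¹' s) ≤ 1 := fun ω => prob_le_one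
    rw [lintegral_sub' ih.1 _ (Filter.Eventually.of_forall hle), ← ih.2]
    · rw [Set.preimage_compl, measure_compl (hXY hs) (measure_ne_top _ _)]
      simp
    · rw [← ih.2]; exact measure_ne_top _ _
  | iUnion f hd hf ih =>
    have hκ : ∀ ω, κ ω (Prod.mk (X ω) ⁻¹' ⋃ i, f i) = ∑' i, κ ω (Prod.mk (X ω) ⁻¹' f i) := by
      intro ω
      rw [Set.preimage_iUnion, measure_iUnion _ fun i => hsec _ (hf i) ω]
      exact fun i j hij => (hd hij).preimage _
    simp only [hκ]
    refine ⟨AEMeasurable.tsum fun i => (ih i).1, ?_⟩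
    rw [lintegral_tsum fun i => (ih i).1]
    rw [Set.preimage_iUnion, measure_iUnion (fun i j hij => (hd hij).preimage _) fun i => hXY (hf i)]
    exact tsum_congr fun i => (ih i).2

/-- Freezing: conditionally on `𝓖`, a `𝓖`-measurable variable may be treated as a constant while
`Y` is integrated against its conditional law. -/
theorem HasCondLaw.lintegral_eq {Ω α β : Type*} {𝓖 : MeasurableSpace Ω}
    [mΩ : MeasurableSpace Ω] [MeasurableSpace α] [MeasurableSpace β] {P : Measure Ω} [IsProbabilityMeasure P]
    (h𝓖 : 𝓖 ≤ mΩ) {X : Ω → α} {Y : Ω → β} {κ : Ω → Measure β}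
    [∀ ω, IsProbabilityMeasure (κ ω)] (h : HasCondLaw P 𝓖 Y κ) (hX : Measurable[𝓖] X)
    (hY : Measurable Y) {f : α × β → ENNReal} (hf : Measurable f) :
    AEMeasurable (fun ω => ∫⁻ y, f (X ω, y) ∂κ ω) P ∧
      ∫⁻ ω, f (X ω, Y ω) ∂P = ∫⁻ ω, ∫⁻ y, f (X ω, y) ∂κ ω ∂P := by
  have hXm : Measurable X := hX.mono h𝓖 le_rfl
  have hXY : Measurable fun ω => (X ω, Y ω) := hXm.prodMk hY
  refine Measurable.ennreal_induction (motive := fun f : α × β → ENNReal =>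
    AEMeasurable (fun ω => ∫⁻ y, f (X ω, y) ∂κ ω) P ∧
      ∫⁻ ω, f (X ω, Y ω) ∂P = ∫⁻ ω, ∫⁻ y, f (X ω, y) ∂κ ω ∂P) ?_ ?_ ?_ hf
  · intro c s hs
    have hs' : ∀ ω, ∫⁻ y, s.indicator (fun _ => c) (X ω, y) ∂κ ω
        = c * κ ω (Prod.mk (X ω) ⁻¹' s) := by
      intro ω
      have : (fun y => s.indicator (fun _ => c) (X ω, y))
          = (Prod.mk (X ω) ⁻¹' s).indicator fun _ => c := by
        rfl
      rw [this, lintegral_indicator_const (measurable_prodMk_left hs)]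
    obtain ⟨h1, h2⟩ := h.measure_preimage_eq h𝓖 hX hY hs
    simp only [hs']
    refine ⟨h1.const_mul c, ?_⟩
    rw [lintegral_const_mul'' _ h1, ← h2]
    have : (fun ω => s.indicator (fun _ => c) (X ω, Y ω))
        = ((fun ω => (X ω, Y ω)) ⁻¹' s).indicator fun _ => c := by
      rfl
    rw [this, lintegral_indicator_const (hXY hs)]
  · intro f g _ hf hg ihf ihg
    have hadd : ∀ ω, ∫⁻ y, (f + g) (X ω, y) ∂κ ω
        = ∫⁻ y, f (X ω, y) ∂κ ω + ∫⁻ y, g (X ω, y) ∂κ ω := fun ω =>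
      lintegral_add_left (hf.comp measurable_prodMk_left) _
    simp only [hadd]
    refine ⟨ihf.1.add ihg.1, ?_⟩
    rw [lintegral_add_left' ihf.1, ← ihf.2, ← ihg.2]
    exact lintegral_add_left (hf.comp hXY) _
  · intro f hf hmono ih
    have hsup : ∀ ω, ∫⁻ y, (⨆ n, f n (X ω, y)) ∂κ ω = ⨆ n, ∫⁻ y, f n (X ω, y) ∂κ ω := fun ω =>
      lintegral_iSup (fun n => (hf n).comp measurable_prodMk_left) fun i j hij y => hmono hij _
    simp only [hsup]
    refine ⟨AEMeasurable.iSup fun n => (ih n).1, ?_⟩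
    have hsup' : ∫⁻ ω, ⨆ n, f n (X ω, Y ω) ∂P = ⨆ n, ∫⁻ ω, f n (X ω, Y ω) ∂P :=
      lintegral_iSup (fun n => (hf n).comp hXY) fun i j hij y => hmono hij _
    rw [hsup', lintegral_iSup' (fun n => (ih n).1)
        (Filter.Eventually.of_forall fun ω i j hij => lintegral_mono fun y => hmono hij _)]
    exact iSup_congr fun n => (ih n).2

/-- A product of factors, frozen as soon as it has reached the level `A`. -/
noncomputable def stoppedProd {Ω : Type*} (A : ENNReal) (Z : ℕ → Ω → ENNReal) : ℕ → Ω → ENNReal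
  | 0 => fun _ => 1
  | t + 1 => fun ω =>
    if A ≤ stoppedProd A Z t ω then stoppedProd A Z t ω else stoppedProd A Z t ω * Z t ω

theorem stoppedProd_eq_or {Ω : Type*} (A : ENNReal) (Z : ℕ → Ω → ENNReal) (ω : Ω) (t : ℕ) :
    A ≤ stoppedProd A Z t ω ∨ stoppedProd A Z t ω = ∏ τ ∈ Finset.range t, Z τ ω := by
  induction t with
  | zero => right; simp [stoppedProd]
  | succ t ih =>
    by_cases hA : A ≤ stoppedProd A Z t ω
    · left; simp [stoppedProd, hA]
    · right; simp [stoppedProd, if_neg hA, Finset.prod_range_succ, ← ih.resolve_left hA]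

theorem le_stoppedProd_of_le {Ω : Type*} {A : ENNReal} {Z : ℕ → Ω → ENNReal} {ω : Ω} {t T : ℕ}
    (htT : t ≤ T) (h : A ≤ stoppedProd A Z t ω) : A ≤ stoppedProd A Z T ω := by
  induction T, htT using Nat.le_induction with
  | base => exact h
  | succ T _ ih => simp [stoppedProd, ih]

/-- Ville's maximal inequality: if every factor `Z t` has conditional expectation at most `1`
given `𝓕 t`, then the running product ever reaches `A` with probability at most `1 / A`. -/
theorem measure_exists_le_prod_le {Ω : Type*} [mΩ : MeasurableSpace Ω] (P : Measure Ω)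
    [IsProbabilityMeasure P] (𝓕 : Filtration ℕ mΩ) (T : ℕ) (A : ENNReal) (hA₀ : A ≠ 0)
    (hA : A ≠ ⊤) (Z : ℕ → Ω → ENNReal) (hZ : ∀ t < T, Measurable[𝓕 (t + 1)] (Z t))
    (hle : ∀ t < T, ∀ G : Ω → ENNReal, Measurable[𝓕 t] G →
      ∫⁻ ω, G ω * Z t ω ∂P ≤ ∫⁻ ω, G ω ∂P) :
    P {ω | ∃ t ≤ T, A ≤ ∏ τ ∈ Finset.range t, Z τ ω} ≤ A⁻¹ := by
  have hmeas : ∀ t ≤ T, Measurable[𝓕 t] (stoppedProd A Z t) := by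
    intro t
    induction t with
    | zero => intro _; exact measurable_const
    | succ t ih =>
      intro ht
      have h1 := (ih (by omega)).mono (𝓕.mono t.le_succ) le_rfl
      refine Measurable.ite ?_ h1 (h1.mul (hZ t ht))
      exact measurableSet_le measurable_const h1
  have hint : ∀ t ≤ T, ∫⁻ ω, stoppedProd A Z t ω ∂P ≤ 1 := by
    intro t
    induction t with
    | zero => intro _; simp [stoppedProd]
    | succ t ih =>
      intro ht
      refine le_trans ?_ (ih (by omega))
      set U := stoppedProd A Z t with hU
      have hUm : Measurable[𝓕 t] U := hmeas t (by omega)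
      have hS : MeasurableSet[𝓕 t] {ω | A ≤ U ω} := measurableSet_le measurable_const hUm
      have hS' : MeasurableSet {ω | A ≤ U ω} := 𝓕.le t _ hS
      have e1 : ∀ ω, stoppedProd A Z (t + 1) ω
          = {ω | A ≤ U ω}.indicator U ω + {ω | A ≤ U ω}ᶜ.indicator U ω * Z t ω := by
        intro ω
        by_cases h : A ≤ U ω <;> simp [stoppedProd, ← hU, h]
      have e2 : ∀ ω, U ω = {ω | A ≤ U ω}.indicator U ω + {ω | A ≤ U ω}ᶜ.indicator U ω := by
        intro ω
        by_cases h : A ≤ U ω <;> simp [h]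
      have hUm' : Measurable U := hUm.mono (𝓕.le t) le_rfl
      rw [lintegral_congr e1, lintegral_congr e2, lintegral_add_left (hUm'.indicator hS'),
        lintegral_add_left (hUm'.indicator hS')]
      exact add_le_add_right (hle t ht _ (hUm.indicator hS.compl)) _
  have hsub : {ω | ∃ t ≤ T, A ≤ ∏ τ ∈ Finset.range t, Z τ ω} ⊆ {ω | A ≤ stoppedProd A Z T ω} := by
    rintro ω ⟨t, ht, h⟩
    refine le_stoppedProd_of_le ht ?_
    rcases stoppedProd_eq_or A Z ω t with h' | h'
    · exact h'
    · rwa [h']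
  refine (measure_mono hsub).trans ?_
  refine (meas_ge_le_lintegral_div ?_ hA₀ hA).trans ?_
  · exact ((hmeas T le_rfl).mono (𝓕.le T) le_rfl).aemeasurable
  · rw [← one_div]
    exact ENNReal.div_le_div_right (hint T le_rfl) _

/-! ### Positive definite matrices and rank-one updates -/

section LinearAlgebra

variable {ι : Type*} [Fintype ι] {V : Matrix ι ι ℝ}

theorem vecMulVec_self_mulVec (s x : ι → ℝ) :
    Matrix.vecMulVec s s *ᵥ x = (s ⬝ᵥ x) • s := by
  simp [Matrix.vecMulVec_mulVec]

theorem dotProduct_mulVec_comm_of_posDef (hV : V.PosDef) (x y : ι → ℝ) :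
    x ⬝ᵥ V *ᵥ y = y ⬝ᵥ V *ᵥ x := by
  have hT : Vᵀ = V := by simpa [Matrix.IsHermitian] using hV.isHermitian
  rw [Matrix.dotProduct_mulVec, ← Matrix.mulVec_transpose, hT, dotProduct_comm]

variable [DecidableEq ι]

theorem inv_mulVec_self_nonneg (hV : V.PosDef) (s : ι → ℝ) : 0 ≤ s ⬝ᵥ V⁻¹ *ᵥ s := by
  simpa using hV.inv.posSemidef.dotProduct_mulVec_nonneg s

theorem mulVec_inv_mulVec (hV : V.PosDef) (s : ι → ℝ) : V *ᵥ V⁻¹ *ᵥ s = s := by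
  rw [Matrix.mulVec_mulVec, Matrix.mul_nonsing_inv _ hV.det_pos.ne'.isUnit, Matrix.one_mulVec]

theorem det_add_vecMulVec_self (hV : V.PosDef) (s : ι → ℝ) :
    (V + Matrix.vecMulVec s s).det = V.det * (1 + s ⬝ᵥ V⁻¹ *ᵥ s) := by
  rw [Matrix.vecMulVec_eq Unit, Matrix.det_add_replicateCol_mul_replicateRow
    hV.det_pos.ne'.isUnit]
  congr 1
  rw [Matrix.det_unique, Matrix.dotProduct_mulVec]
  simp [Matrix.mul_apply, dotProduct, Matrix.vecMul]

/-- The Sherman–Morrison formula, for the quadratic form of `V` at the solution of a linear system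
whose matrix and right-hand side both receive a rank-one update. -/
theorem dotProduct_mulVec_add_vecMulVec (hV : V.PosDef) (s u u' : ι → ℝ) (η : ℝ)
    (hu : (V + Matrix.vecMulVec s s) *ᵥ u' = V *ᵥ u + η • s) :
    u' ⬝ᵥ (V + Matrix.vecMulVec s s) *ᵥ u' = u ⬝ᵥ V *ᵥ u +
      (2 * η * (s ⬝ᵥ u) + η ^ 2 * (s ⬝ᵥ V⁻¹ *ᵥ s) - (s ⬝ᵥ u) ^ 2)
        / (1 + s ⬝ᵥ V⁻¹ *ᵥ s) := by
  have hw := inv_mulVec_self_nonneg hV s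
  set y := V⁻¹ *ᵥ s with hy
  set w := s ⬝ᵥ y with hw'
  set m := s ⬝ᵥ u with hm
  have hVy : V *ᵥ y = s := mulVec_inv_mulVec hV s
  have hV' : (V + Matrix.vecMulVec s s).PosDef :=
    hV.add_posSemidef (by simpa using Matrix.posSemidef_vecMulVec_self_star s)
  have hw1 : 1 + w ≠ 0 := by positivity
  obtain ⟨k, hk⟩ : ∃ k, k * (1 + w) = η - m := ⟨(η - m) / (1 + w), by field_simp⟩
  have hu' : u' = u + k • y := by
    have hinj : Function.Injective (V + Matrix.vecMulVec s s).mulVec :=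
      Matrix.mulVec_injective_of_isUnit hV'.isUnit
    apply hinj
    rw [hu]
    simp only [Matrix.add_mulVec, Matrix.mulVec_add, Matrix.mulVec_smul, vecMulVec_self_mulVec,
      hVy, ← hm, ← hw']
    have : η = m + k + k * w := by linarith
    rw [this]
    module
  have hyu : y ⬝ᵥ V *ᵥ u = m := by rw [dotProduct_mulVec_comm_of_posDef hV, hVy, dotProduct_comm]
  have hys : y ⬝ᵥ s = w := by rw [dotProduct_comm]
  have hus : u ⬝ᵥ s = m := by rw [dotProduct_comm]
  rw [hu, hu']
  simp only [add_dotProduct, dotProduct_add, smul_dotProduct, dotProduct_smul, hyu, hys, hus,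
    smul_eq_mul]
  have : k = (η - m) / (1 + w) := by rw [← hk]; field_simp
  rw [this]
  field_simp
  ring

theorem sq_dotProduct_le (hV : V.PosDef) (s u : ι → ℝ) :
    (s ⬝ᵥ u) ^ 2 ≤ (s ⬝ᵥ V⁻¹ *ᵥ s) * (u ⬝ᵥ V *ᵥ u) := by
  by_cases hs : s = 0
  · simp [hs]
  have hw : 0 < s ⬝ᵥ V⁻¹ *ᵥ s := by simpa using hV.inv.dotProduct_mulVec_pos hs
  set y := V⁻¹ *ᵥ s with hy
  set w := s ⬝ᵥ y with hw'
  set m := s ⬝ᵥ u with hm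
  have hVy : V *ᵥ y = s := mulVec_inv_mulVec hV s
  have hyu : y ⬝ᵥ V *ᵥ u = m := by rw [dotProduct_mulVec_comm_of_posDef hV, hVy, dotProduct_comm]
  have hys : y ⬝ᵥ s = w := by rw [dotProduct_comm]
  have hus : u ⬝ᵥ s = m := by rw [dotProduct_comm]
  have h := hV.posSemidef.dotProduct_mulVec_nonneg (w • u - m • y)
  simp only [star_trivial, Matrix.mulVec_sub, Matrix.mulVec_smul, hVy, sub_dotProduct,
    dotProduct_sub, smul_dotProduct, dotProduct_smul, hyu, hys, hus, smul_eq_mul] at h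
  have h2 : 0 ≤ w * (w * (u ⬝ᵥ V *ᵥ u) - m ^ 2) := by nlinarith
  have := nonneg_of_mul_nonneg_right h2 hw
  linarith

theorem inv_mulVec_self_le (hV : V.PosDef) (hV1 : ∀ x, x ⬝ᵥ x ≤ x ⬝ᵥ V *ᵥ x) (s : ι → ℝ) :
    s ⬝ᵥ V⁻¹ *ᵥ s ≤ s ⬝ᵥ s := by
  set y := V⁻¹ *ᵥ s with hy
  have h1 := hV1 y
  rw [mulVec_inv_mulVec hV, dotProduct_comm y s] at h1
  have h2 : 0 ≤ (s - y) ⬝ᵥ (s - y) := by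
    simpa using dotProduct_star_self_nonneg (s - y)
  simp only [sub_dotProduct, dotProduct_sub, dotProduct_comm y s] at h2
  linarith

/-- The inequality of arithmetic and geometric means for the eigenvalues, in logarithmic form. -/
theorem log_det_le (hV : V.PosDef) {t : ℝ} (ht : 0 < t) (htr : V.trace ≤ Fintype.card ι * t) :
    Real.log V.det ≤ Fintype.card ι * Real.log t := by
  have hpos := fun i => hV.eigenvalues_pos i
  rw [hV.isHermitian.det_eq_prod_eigenvalues]
  rw [hV.isHermitian.trace_eq_sum_eigenvalues] at htr
  simp only [RCLike.ofReal_real_eq_id, id_eq] at htr ⊢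
  rw [Real.log_prod fun i _ => (hpos i).ne']
  have h : ∀ i, Real.log (hV.isHermitian.eigenvalues i)
      ≤ hV.isHermitian.eigenvalues i / t - 1 + Real.log t := by
    intro i
    have := Real.log_le_sub_one_of_pos (div_pos (hpos i) ht)
    rw [Real.log_div (hpos i).ne' ht.ne'] at this
    linarith
  refine (Finset.sum_le_sum fun i _ => h i).trans ?_
  rw [Finset.sum_add_distrib, Finset.sum_sub_distrib, ← Finset.sum_div]
  simp only [Finset.sum_const, Finset.card_univ, nsmul_eq_mul, mul_one]
  have : (∑ i, hV.isHermitian.eigenvalues i) / t ≤ Fintype.card ι := by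
    rwa [div_le_iff₀ ht]
  linarith

end LinearAlgebra

/-! ### The posterior parameters -/

section Posterior

variable {d K : ℕ} (s : ℕ → EuclideanSpace ℝ (Fin d)) (a : ℕ → Fin K) (R : ℕ → ℝ)
  (θ : Fin K → EuclideanSpace ℝ (Fin d))

theorem precision_posDef (t : ℕ) (b : Fin K) : (precision s a t b).PosDef :=
  Matrix.PosDef.one.add_posSemidef (Matrix.posSemidef_sum _ fun τ _ => by
    simpa using Matrix.posSemidef_vecMulVec_self_star (s τ).ofLp)

theorem precision_one (b : Fin K) : precision s a 1 b = 1 := by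
  simp [precision]

theorem filter_Ico_succ {t : ℕ} (ht : 1 ≤ t) (b : Fin K) :
    (Finset.Ico 1 (t + 1)).filter (fun τ => a τ = b) =
      if a t = b then insert t ((Finset.Ico 1 t).filter fun τ => a τ = b)
      else (Finset.Ico 1 t).filter fun τ => a τ = b := by
  rw [← Finset.insert_Ico_right_eq_Ico_add_one ht, Finset.filter_insert]

theorem precision_succ {t : ℕ} (ht : 1 ≤ t) (b : Fin K) :
    precision s a (t + 1) b = precision s a t b +
      if a t = b then Matrix.vecMulVec (s t).ofLp (s t).ofLp else 0 := by
  unfold precision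
  rw [filter_Ico_succ a ht]
  split_ifs
  · rw [Finset.sum_insert (by simp)]; abel
  · simp

theorem precision_mulVec_estimate (t : ℕ) (b : Fin K) :
    precision s a t b *ᵥ estimate s a R t b =
      ∑ τ ∈ (Finset.Ico 1 t).filter (fun τ => a τ = b), R τ • (s τ).ofLp :=
  mulVec_inv_mulVec (precision_posDef s a t b) _

theorem precision_mulVec_estimate_succ {t : ℕ} (ht : 1 ≤ t) (b : Fin K) :
    precision s a (t + 1) b *ᵥ estimate s a R (t + 1) b =
      precision s a t b *ᵥ estimate s a R t b + if a t = b then R t • (s t).ofLp else 0 := by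
  rw [precision_mulVec_estimate, precision_mulVec_estimate, filter_Ico_succ a ht]
  split_ifs
  · rw [Finset.sum_insert (by simp)]; abel
  · simp

theorem dotProduct_self_le_precision (t : ℕ) (b : Fin K) (x : Fin d → ℝ) :
    x ⬝ᵥ x ≤ x ⬝ᵥ precision s a t b *ᵥ x := by
  have h : (∑ τ ∈ (Finset.Ico 1 t).filter (fun τ => a τ = b),
      Matrix.vecMulVec (s τ).ofLp (s τ).ofLp).PosSemidef :=
    Matrix.posSemidef_sum _ fun τ _ => by
      simpa using Matrix.posSemidef_vecMulVec_self_star (s τ).ofLp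
  have := h.dotProduct_mulVec_nonneg x
  simp only [star_trivial] at this
  rw [precision, Matrix.add_mulVec, Matrix.one_mulVec, dotProduct_add]
  linarith

theorem dotProduct_ofLp_self (x : EuclideanSpace ℝ (Fin d)) : x.ofLp ⬝ᵥ x.ofLp = ‖x‖ ^ 2 := by
  rw [EuclideanSpace.real_norm_sq_eq]
  simp [dotProduct, sq]

/-- The variance of the prediction `sᵀ θ̂_b`: the squared width `sᵀ V_b⁻¹ s`. -/
noncomputable def postVar (t : ℕ) (b : Fin K) : ℝ :=
  (s t).ofLp ⬝ᵥ (precision s a t b)⁻¹ *ᵥ (s t).ofLp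

theorem postVar_nonneg (t : ℕ) (b : Fin K) : 0 ≤ postVar s a t b :=
  inv_mulVec_self_nonneg (precision_posDef s a t b) _

theorem postVar_le_one {t : ℕ} (hs : ‖s t‖ ≤ 1) (b : Fin K) : postVar s a t b ≤ 1 := by
  refine (inv_mulVec_self_le (precision_posDef s a t b)
    (dotProduct_self_le_precision s a t b) _).trans ?_
  rw [dotProduct_ofLp_self]
  nlinarith [norm_nonneg (s t)]

theorem det_precision_succ {t : ℕ} (ht : 1 ≤ t) (b : Fin K) :
    (precision s a (t + 1) b).det =
      (precision s a t b).det * if a t = b then 1 + postVar s a t b else 1 := by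
  rw [precision_succ s a ht]
  split_ifs
  · exact det_add_vecMulVec_self (precision_posDef s a t b) _
  · simp

theorem trace_precision_le {t : ℕ} (ht : 1 ≤ t) (hs : ∀ τ ∈ Finset.Ico 1 t, ‖s τ‖ ≤ 1)
    (b : Fin K) : (precision s a t b).trace ≤ d + (t - 1 : ℝ) := by
  rw [precision, Matrix.trace_add, Matrix.trace_one, Fintype.card_fin, Matrix.trace_sum]
  gcongr
  have h : ∀ τ ∈ (Finset.Ico 1 t).filter (fun τ => a τ = b),
      (Matrix.vecMulVec (s τ).ofLp (s τ).ofLp).trace ≤ 1 := by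
    intro τ hτ
    have := hs τ (Finset.mem_filter.1 hτ).1
    rw [Matrix.trace_vecMulVec, dotProduct_ofLp_self]
    nlinarith [norm_nonneg (s τ)]
  refine (Finset.sum_le_card_nsmul _ _ _ h).trans ?_
  have hc : ((Finset.Ico 1 t).filter (fun τ => a τ = b)).card ≤ t - 1 := by
    simpa using Finset.card_filter_le (Finset.Ico 1 t) (fun τ => a τ = b)
  have : (((Finset.Ico 1 t).filter (fun τ => a τ = b)).card : ℝ) ≤ ((t - 1 : ℕ) : ℝ) := by
    exact_mod_cast hc
  rw [Nat.cast_sub ht, Nat.cast_one] at this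
  simpa using this

theorem log_det_precision_le {t : ℕ} (ht : 1 ≤ t) (hs : ∀ τ ∈ Finset.Ico 1 t, ‖s τ‖ ≤ 1)
    (b : Fin K) : Real.log (precision s a t b).det ≤ d * Real.log t := by
  have ht' : (1 : ℝ) ≤ t := by exact_mod_cast ht
  rcases Nat.eq_zero_or_pos d with rfl | hd
  · simp
  have hd' : (1 : ℝ) ≤ d := by exact_mod_cast hd
  have := log_det_le (precision_posDef s a t b) (t := t) (by linarith) (by
    refine (trace_precision_le s a ht hs b).trans ?_
    rw [Fintype.card_fin]
    nlinarith)
  simpa using this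

/-- The elliptical potential inequality for the pulls of all the arms together. -/
theorem sum_postVar_le {T : ℕ} (hs : ∀ τ ∈ Finset.Icc 1 T, ‖s τ‖ ≤ 1) :
    ∑ t ∈ Finset.Icc 1 T, postVar s a t (a t) ≤ 2 * (K * (d * Real.log (T + 1))) := by
  have hIcc : Finset.Icc 1 T = Finset.Ico 1 (T + 1) := by ext; simp
  have hlog : ∀ N, ∑ t ∈ Finset.Ico 1 (N + 1), Real.log (1 + postVar s a t (a t)) =
      ∑ b, Real.log (precision s a (N + 1) b).det := by
    intro N
    induction N with
    | zero => simp [precision_one]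
    | succ N ih =>
      rw [Finset.sum_Ico_succ_top (by omega), ih]
      have h : ∀ b, Real.log (precision s a (N + 1 + 1) b).det =
          Real.log (precision s a (N + 1) b).det +
            if b = a (N + 1) then Real.log (1 + postVar s a (N + 1) b) else 0 := by
        intro b
        rw [det_precision_succ s a (by omega), Real.log_mul
          (precision_posDef s a (N + 1) b).det_pos.ne']
        · by_cases hb : a (N + 1) = b
          · simp [hb]
          · simp [hb, Ne.symm hb]
        · have := postVar_nonneg s a (N + 1) b
          split_ifs <;> positivity
      rw [Finset.sum_congr rfl fun b _ => h b, Finset.sum_add_distrib, Finset.sum_ite_eq']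
      simp
  have h1 : ∀ t ∈ Finset.Icc 1 T,
      postVar s a t (a t) ≤ 2 * Real.log (1 + postVar s a t (a t)) := by
    intro t ht
    have h0 := postVar_nonneg s a t (a t)
    have h1 := postVar_le_one s a (hs t ht) (a t)
    have h2 := Real.one_sub_inv_le_log_of_pos (show 0 < 1 + postVar s a t (a t) by linarith)
    have h3 : postVar s a t (a t) / 2 ≤ 1 - (1 + postVar s a t (a t))⁻¹ := by
      have : 1 - (1 + postVar s a t (a t))⁻¹
          = postVar s a t (a t) / (1 + postVar s a t (a t)) := by
        field_simp
        ring
      rw [this]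
      exact div_le_div_of_nonneg_left h0 (by linarith) (by linarith)
    linarith
  refine (Finset.sum_le_sum h1).trans ?_
  rw [← Finset.mul_sum, hIcc, hlog T]
  gcongr
  have := Finset.sum_le_card_nsmul Finset.univ
    (fun b => Real.log (precision s a (T + 1) b).det) (d * Real.log (T + 1)) fun b _ => by
      have := log_det_precision_le s a (t := T + 1) (by omega)
        (fun τ hτ => hs τ (by rw [hIcc]; exact hτ)) b
      simpa using this
  simpa using this

/-- The exponential potential `det(V_b)^(-1/2) exp(2 ‖θ̂_b - θ_b‖²_{V_b})` of the estimation error.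
The factor `2 = 1 / (2 σ²)` is the one for rewards in `[0, 1]`, whose sub-Gaussian
parameter is `σ = 1 / 2`. -/
noncomputable def errPotential (t : ℕ) (b : Fin K) : ℝ :=
  (√(precision s a t b).det)⁻¹ * Real.exp (2 *
    ((estimate s a R t b - (θ b).ofLp) ⬝ᵥ
      precision s a t b *ᵥ (estimate s a R t b - (θ b).ofLp)))

/-- The factor by which `errPotential` changes when an arm is pulled with prediction variance
`w`, prediction error `m` and reward noise `η`. -/
noncomputable def errFactor (w m η : ℝ) : ℝ :=
  (√(1 + w))⁻¹ * Real.exp (2 * ((2 * η * m + η ^ 2 * w - m ^ 2) / (1 + w)))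

theorem errPotential_one (b : Fin K) :
    errPotential s a R θ 1 b = Real.exp (2 * ‖θ b‖ ^ 2) := by
  simp [errPotential, precision_one, estimate, dotProduct_ofLp_self]

theorem errPotential_succ {t : ℕ} (ht : 1 ≤ t) (b : Fin K) :
    errPotential s a R θ (t + 1) b = errPotential s a R θ t b *
      if a t = b then errFactor (postVar s a t b)
        ((s t).ofLp ⬝ᵥ estimate s a R t b - expReward θ (s t) b) (R t - expReward θ (s t) b)
      else 1 := by
  have hV := precision_posDef s a t b
  have hdet := det_precision_succ s a ht b
  have hest := precision_mulVec_estimate_succ s a R ht b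
  have hprec := precision_succ s a ht b
  by_cases hb : a t = b
  · rw [if_pos hb] at hdet hest hprec ⊢
    have hu : precision s a (t + 1) b *ᵥ (estimate s a R (t + 1) b - (θ b).ofLp) =
        precision s a t b *ᵥ (estimate s a R t b - (θ b).ofLp) +
          (R t - expReward θ (s t) b) • (s t).ofLp := by
      rw [Matrix.mulVec_sub, hest, hprec, Matrix.add_mulVec, vecMulVec_self_mulVec,
        Matrix.mulVec_sub, expReward]
      module
    rw [hprec] at hu
    have hq := dotProduct_mulVec_add_vecMulVec hV _ _ _ _ hu
    rw [errPotential, hdet, hprec, hq, Real.sqrt_mul hV.det_pos.le, mul_add, Real.exp_add,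
      errPotential, errFactor, dotProduct_sub, ← expReward, mul_inv, ← postVar]
    ring
  · rw [if_neg hb] at hdet hest hprec ⊢
    simp only [add_zero] at hest hprec
    have hest' : estimate s a R (t + 1) b = estimate s a R t b := by
      rw [hprec] at hest
      exact Matrix.mulVec_injective_of_isUnit hV.isUnit hest
    rw [errPotential, errPotential, hprec, hest', mul_one]

/-- A bound on the potential turns into a confidence bound on the prediction. -/
theorem sq_predictionError_le {t : ℕ} (b : Fin K) {A : ℝ}
    (hA : errPotential s a R θ t b ≤ A) :
    ((s t).ofLp ⬝ᵥ estimate s a R t b - expReward θ (s t) b) ^ 2 ≤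
      postVar s a t b * (Real.log A / 2 + Real.log (precision s a t b).det / 4) := by
  have hV := precision_posDef s a t b
  have h1 := sq_dotProduct_le hV (s t).ofLp (estimate s a R t b - (θ b).ofLp)
  rw [dotProduct_sub, ← expReward] at h1
  refine h1.trans (mul_le_mul_of_nonneg_left ?_ (postVar_nonneg s a t b))
  have hD : 0 < errPotential s a R θ t b :=
    mul_pos (inv_pos.2 (Real.sqrt_pos.2 hV.det_pos)) (Real.exp_pos _)
  have h2 := Real.log_le_log hD hA
  rw [errPotential, Real.log_mul (inv_pos.2 (Real.sqrt_pos.2 hV.det_pos)).ne'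
    (Real.exp_pos _).ne', Real.log_inv, Real.log_exp, Real.log_sqrt hV.det_pos.le] at h2
  linarith

end Posterior

/-! ### Gaussian and sub-Gaussian estimates -/

theorem gaussianReal_eq_map_std (μ : ℝ) {v : ℝ} (hv : 0 ≤ v) :
    gaussianReal μ v.toNNReal = (gaussianReal 0 1).map fun z => μ + √v * z := by
  have h : (fun z => μ + √v * z) = (fun x => μ + x) ∘ fun z : ℝ => √v * z := rfl
  rw [h, ← Measure.map_map (by fun_prop) (by fun_prop), gaussianReal_map_const_mul,
    gaussianReal_map_const_add]
  congr 1
  · simp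
  · ext; simp [Real.sq_sqrt hv, hv]

theorem hasDerivAt_neg_exp_neg_sq_half (x : ℝ) :
    HasDerivAt (fun x => -Real.exp (-(x ^ 2 / 2))) (x * Real.exp (-(x ^ 2 / 2))) x := by
  have h1 : HasDerivAt (fun x : ℝ => -(x ^ 2 / 2)) (-x) x := by
    have := ((hasDerivAt_pow 2 x).div_const 2).neg
    exact this.congr_deriv (by simp)
  exact h1.exp.neg.congr_deriv (by ring)

/-- The anti-concentration constant `4 √π e`: a standard Gaussian exceeds `4 / 3` with probability
at least its inverse. -/
theorem le_gaussianReal_Ici :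
    (4 * √Real.pi * Real.exp 1)⁻¹ ≤ (gaussianReal 0 1).real (Set.Ici (4 / 3)) := by
  -- the tail is bounded below by the integral of `(x / b) exp (-x² / 2)` over `[4 / 3, b]`,
  -- where `b² / 2 = (4 / 3)² / 2 + 2`
  set b : ℝ := √(52 / 9) with hb
  have hb2 : b ^ 2 = 52 / 9 := Real.sq_sqrt (by norm_num)
  have hb0 : 0 < b := Real.sqrt_pos.2 (by norm_num)
  have hb43 : 4 / 3 ≤ b := Real.le_sqrt_of_sq_le (by norm_num)
  have hint : ∫ x in (4 / 3 : ℝ)..b, x * Real.exp (-(x ^ 2 / 2)) =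
      Real.exp (-(8 / 9)) - Real.exp (-(26 / 9)) := by
    rw [intervalIntegral.integral_eq_sub_of_hasDerivAt
      (fun x _ => hasDerivAt_neg_exp_neg_sq_half x)
      ((by fun_prop : Continuous fun x : ℝ => x * Real.exp (-(x ^ 2 / 2))).intervalIntegrable _ _)]
    rw [hb2]
    norm_num
    ring
  have hpdf : ∀ x, gaussianPDFReal 0 1 x = (√(2 * Real.pi))⁻¹ * Real.exp (-(x ^ 2 / 2)) := by
    intro x
    simp [gaussianPDFReal, neg_div]
  have hcont : Continuous fun x : ℝ => b⁻¹ * (√(2 * Real.pi))⁻¹ * (x * Real.exp (-(x ^ 2 / 2))) := by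
    fun_prop
  have h1 : b⁻¹ * (√(2 * Real.pi))⁻¹ * (Real.exp (-(8 / 9)) - Real.exp (-(26 / 9))) ≤
      (gaussianReal 0 1).real (Set.Ici (4 / 3)) := by
    rw [Measure.real, gaussianReal_apply_eq_integral _ one_ne_zero, ENNReal.toReal_ofReal
      (integral_nonneg fun x => gaussianPDFReal_nonneg _ _ _), ← hint,
      ← intervalIntegral.integral_const_mul, intervalIntegral.integral_of_le hb43]
    refine le_trans ?_ (setIntegral_mono_set (integrable_gaussianPDFReal 0 1).integrableOn
      (Filter.Eventually.of_forall fun x => gaussianPDFReal_nonneg _ _ _)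
      (s := Set.Ioc (4 / 3) b) (LE.le.eventuallyLE fun x hx => hx.1.le))
    refine setIntegral_mono_on (hcont.integrableOn_Ioc)
      (integrable_gaussianPDFReal 0 1).integrableOn measurableSet_Ioc fun x hx => ?_
    rw [hpdf]
    have : b⁻¹ * x ≤ 1 := by
      rw [inv_mul_le_iff₀ hb0]; linarith [hx.2]
    calc b⁻¹ * (√(2 * Real.pi))⁻¹ * (x * Real.exp (-(x ^ 2 / 2)))
        = (b⁻¹ * x) * ((√(2 * Real.pi))⁻¹ * Real.exp (-(x ^ 2 / 2))) := by ring
      _ ≤ 1 * ((√(2 * Real.pi))⁻¹ * Real.exp (-(x ^ 2 / 2))) := by gcongr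
      _ = _ := one_mul _
  refine le_trans ?_ h1
  have he : Real.exp (-(26 / 9)) = Real.exp (-(8 / 9)) * Real.exp (-2) := by
    rw [← Real.exp_add]; norm_num
  have he2 : Real.exp (-2) ≤ 1 / 7 := by
    rw [Real.exp_neg, one_div]
    refine inv_anti₀ (by norm_num) ?_
    have h := Real.exp_one_gt_d9
    have : Real.exp 2 = Real.exp 1 * Real.exp 1 := by rw [← Real.exp_add]; norm_num
    rw [this]
    nlinarith
  have he3 : Real.exp (-(8 / 9)) * Real.exp 1 ≥ 10 / 9 := by
    rw [← Real.exp_add]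
    have := Real.add_one_le_exp (-(8 / 9) + 1 : ℝ)
    linarith
  have hbu : b ≤ 12 / 5 + 1 / 100 := by
    rw [hb, Real.sqrt_le_left (by norm_num)]; norm_num
  have hs2 : √2 ≤ 3 / 2 - 8 / 100 := by
    rw [Real.sqrt_le_left (by norm_num)]; norm_num
  have hsp : 0 < √Real.pi := Real.sqrt_pos.2 Real.pi_pos
  have hs20 : 0 < √(2 : ℝ) := by positivity
  have he0 := Real.exp_pos (-(8 / 9) : ℝ)
  have he10 := Real.exp_pos (1 : ℝ)
  rw [Real.sqrt_mul (by norm_num), he, ← mul_inv, inv_mul_eq_div, inv_eq_one_div,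
    div_le_div_iff₀ (by positivity) (by positivity)]
  have h3 : b * √2 ≤ (12 / 5 + 1 / 100) * (3 / 2 - 8 / 100) := by gcongr
  have h4 : 10 / 9 * (6 / 7) ≤ (Real.exp (-(8 / 9)) * Real.exp 1) * (1 - Real.exp (-2)) := by
    gcongr; linarith
  have h5 : b * √2 ≤ 4 * ((Real.exp (-(8 / 9)) * Real.exp 1) * (1 - Real.exp (-2))) := by
    linarith
  nlinarith

theorem gaussianReal_std_real_Ici_le {g : ℝ} (hg : 0 ≤ g) :
    (gaussianReal 0 1).real (Set.Ici g) ≤ Real.exp (-(g ^ 2 / 2)) := by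
  have h := measure_ge_le_exp_mul_mgf (μ := gaussianReal 0 1) (X := id) g hg
    (integrable_exp_mul_gaussianReal g)
  rw [mgf_id_gaussianReal] at h
  refine h.trans_eq ?_
  rw [← Real.exp_add]
  congr 1
  simp
  ring

theorem gaussianReal_std_abs_le {g : ℝ} (hg : 0 ≤ g) :
    gaussianReal 0 1 {z | g < |z|} ≤ ENNReal.ofReal (2 * Real.exp (-(g ^ 2 / 2))) := by
  have h1 : gaussianReal 0 1 (Set.Ici g) ≤ ENNReal.ofReal (Real.exp (-(g ^ 2 / 2))) := by
    rw [← ofReal_measureReal]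
    exact ENNReal.ofReal_le_ofReal (gaussianReal_std_real_Ici_le hg)
  have h2 : gaussianReal 0 1 ((fun x => -x) ⁻¹' Set.Ici g) = gaussianReal 0 1 (Set.Ici g) := by
    rw [← Measure.map_apply measurable_neg measurableSet_Ici]
    have := gaussianReal_map_neg (μ := 0) (v := 1)
    rw [this, neg_zero]
  refine (measure_mono (t := Set.Ici g ∪ (fun x => -x) ⁻¹' Set.Ici g) ?_).trans ?_
  · intro z (hz : g < |z|)
    rcases lt_abs.1 hz with h | h
    · left; exact h.le
    · right; exact h.le
  · refine (measure_union_le _ _).trans ?_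
    rw [h2, two_mul, ENNReal.ofReal_add (by positivity) (by positivity)]
    gcongr

/-- A degenerate Gaussian satisfies the bound as well, since the inequality is strict. -/
theorem gaussianReal_abs_sub_le (μ : ℝ) {v g : ℝ} (hv : 0 ≤ v) (hg : 0 ≤ g) :
    gaussianReal μ v.toNNReal {y | g * √v < |y - μ|} ≤
      ENNReal.ofReal (2 * Real.exp (-(g ^ 2 / 2))) := by
  rw [gaussianReal_eq_map_std μ hv, Measure.map_apply (by fun_prop)
    (measurableSet_lt (by fun_prop) (by fun_prop))]
  refine (measure_mono ?_).trans (gaussianReal_std_abs_le hg)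
  intro z hz
  simp only [Set.mem_preimage, Set.mem_ofPred_eq, add_sub_cancel_left, abs_mul,
    abs_of_nonneg (Real.sqrt_nonneg v)] at hz ⊢
  rw [mul_comm] at hz
  exact lt_of_mul_lt_mul_left hz (Real.sqrt_nonneg v)

theorem le_gaussianReal_real_Ici (μ : ℝ) {v x : ℝ} (hv : 0 ≤ v) (hx : x ≤ μ + 4 / 3 * √v) :
    ENNReal.ofReal (4 * √Real.pi * Real.exp 1)⁻¹ ≤ gaussianReal μ v.toNNReal (Set.Ici x) := by
  rw [gaussianReal_eq_map_std μ hv, Measure.map_apply (by fun_prop) measurableSet_Ici]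
  refine le_trans (ENNReal.ofReal_le_ofReal le_gaussianReal_Ici) ?_
  rw [ofReal_measureReal]
  refine measure_mono fun z (hz : 4 / 3 ≤ z) => ?_
  simp only [Set.mem_preimage, Set.mem_Ici]
  nlinarith [Real.sqrt_nonneg v]

theorem integral_exp_quadratic {b : ℝ} (hb : 0 < b) (β γ : ℝ) :
    Integrable (fun x => Real.exp (-b * x ^ 2 + β * x + γ)) ∧
      ∫ x, Real.exp (-b * x ^ 2 + β * x + γ) =
        √(Real.pi / b) * Real.exp (β ^ 2 / (4 * b) + γ) := by
  have h : (fun x => Real.exp (-b * x ^ 2 + β * x + γ)) = fun x =>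
      Real.exp (β ^ 2 / (4 * b) + γ) * Real.exp (-b * (x - β / (2 * b)) ^ 2) := by
    ext x
    rw [← Real.exp_add]
    congr 1
    field_simp
    ring
  rw [h]
  constructor
  · exact ((integrable_exp_neg_mul_sq hb).comp_sub_right (β / (2 * b))).const_mul _
  · rw [integral_const_mul, integral_sub_right_eq_self fun x => Real.exp (-b * x ^ 2),
      integral_gaussian, mul_comm]

theorem lintegral_exp_gaussianReal_std {w : ℝ} (hw : 0 ≤ w) (β γ : ℝ) :
    ∫⁻ z, ENNReal.ofReal (Real.exp (β * z + γ - w * z ^ 2 / 2)) ∂gaussianReal 0 1 =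
      ENNReal.ofReal ((√(1 + w))⁻¹ * Real.exp (β ^ 2 / (2 * (1 + w)) + γ)) := by
  rw [gaussianReal_of_var_ne_zero _ one_ne_zero, lintegral_withDensity_eq_lintegral_mul _
    (by fun_prop) (by fun_prop)]
  have hb : 0 < (1 + w) / 2 := by positivity
  obtain ⟨h1, h2⟩ := integral_exp_quadratic hb β γ
  have e : ∀ z, (gaussianPDF 0 1 * fun z =>
      ENNReal.ofReal (Real.exp (β * z + γ - w * z ^ 2 / 2))) z =
      ENNReal.ofReal ((√(2 * Real.pi))⁻¹ * Real.exp (-((1 + w) / 2) * z ^ 2 + β * z + γ)) := by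
    intro z
    simp only [Pi.mul_apply, gaussianPDF]
    rw [← ENNReal.ofReal_mul (gaussianPDFReal_nonneg _ _ _)]
    congr 1
    simp only [gaussianPDFReal, NNReal.coe_one, mul_one, sub_zero]
    rw [mul_assoc, ← Real.exp_add]
    congr 2
    ring
  rw [lintegral_congr e, ← ofReal_integral_eq_lintegral_ofReal (h1.const_mul _)
    (Filter.Eventually.of_forall fun z => by positivity), integral_const_mul, h2]
  congr 1
  have h3 : √(Real.pi / ((1 + w) / 2)) = √(2 * Real.pi) * (√(1 + w))⁻¹ := by
    rw [← Real.sqrt_inv, ← Real.sqrt_mul (by positivity)]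
    congr 1
    field_simp
  have h4 : √(2 * Real.pi) ≠ 0 := by positivity
  have h5 : β ^ 2 / (4 * ((1 + w) / 2)) = β ^ 2 / (2 * (1 + w)) := by ring
  rw [h3, h5, mul_assoc, inv_mul_cancel_left₀ h4]

/-- `errFactor` is a Gaussian mixture, over the slope `g ~ N(m, w / 4)`, of the exponential weights
`exp (4 η g - 2 g²)` that appear in Hoeffding's lemma. -/
theorem ofReal_errFactor_eq {w : ℝ} (hw : 0 ≤ w) (m η : ℝ) :
    ENNReal.ofReal (errFactor w m η) = ∫⁻ z, ENNReal.ofReal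
      (Real.exp (4 * η * (m + √w / 2 * z) - 2 * (m + √w / 2 * z) ^ 2)) ∂gaussianReal 0 1 := by
  have e : ∀ z, 4 * η * (m + √w / 2 * z) - 2 * (m + √w / 2 * z) ^ 2 =
      (2 * √w * (η - m)) * z + (4 * η * m - 2 * m ^ 2) - w * z ^ 2 / 2 := by
    intro z
    have := Real.sq_sqrt hw
    linear_combination (-z ^ 2 / 2) * this
  simp only [e]
  rw [lintegral_exp_gaussianReal_std hw, errFactor]
  congr 3
  have : (2 * √w * (η - m)) ^ 2 = 4 * w * (η - m) ^ 2 := by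
    rw [mul_pow, mul_pow, Real.sq_sqrt hw]; ring
  rw [this]
  field_simp
  ring

theorem hoeffding_exp_le {β : Type*} [MeasurableSpace β] {κ : Measure β}
    [IsProbabilityMeasure κ] {f : β → ℝ}
    (hf : AEMeasurable f κ) {lo hi : ℝ} (h01 : ∀ᵐ x ∂κ, f x ∈ Set.Icc lo hi) (l : ℝ) :
    ∫⁻ x, ENNReal.ofReal (Real.exp (l * (f x - ∫ x, f x ∂κ))) ∂κ ≤
      ENNReal.ofReal (Real.exp ((hi - lo) ^ 2 * l ^ 2 / 8)) := by
  have h := hasSubgaussianMGF_of_mem_Icc hf h01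
  rw [← ofReal_integral_eq_lintegral_ofReal (h.integrable_exp_mul l)
    (Filter.Eventually.of_forall fun x => by positivity)]
  refine ENNReal.ofReal_le_ofReal ((h.mgf_le l).trans_eq ?_)
  congr 1
  simp only [NNReal.coe_pow, NNReal.coe_div, coe_nnnorm, Real.norm_eq_abs, NNReal.coe_ofNat,
    div_pow, sq_abs]
  ring

/-- The error potential is, on average over the reward, not increased by a pull. -/
theorem lintegral_errFactor_le {κ : Measure ℝ} [IsProbabilityMeasure κ]
    (h01 : ∀ᵐ x ∂κ, x ∈ Set.Icc (0 : ℝ) 1) {w : ℝ} (hw : 0 ≤ w) (m : ℝ) :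
    ∫⁻ x, ENNReal.ofReal (errFactor w m (x - ∫ x, x ∂κ)) ∂κ ≤ 1 := by
  simp only [ofReal_errFactor_eq hw]
  rw [lintegral_lintegral_swap (by fun_prop)]
  have h : ∀ z, ∫⁻ x, ENNReal.ofReal (Real.exp (4 * (x - ∫ x, x ∂κ) * (m + √w / 2 * z)
      - 2 * (m + √w / 2 * z) ^ 2)) ∂κ ≤ 1 := by
    intro z
    set g := m + √w / 2 * z
    have hH := hoeffding_exp_le (κ := κ) (f := fun x => x) (by fun_prop) h01 (4 * g)
    have e : ∀ x, ENNReal.ofReal (Real.exp (4 * (x - ∫ x, x ∂κ) * g - 2 * g ^ 2)) =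
        ENNReal.ofReal (Real.exp (4 * g * (x - ∫ x, x ∂κ))) *
          ENNReal.ofReal (Real.exp (-2 * g ^ 2)) := by
      intro x
      rw [← ENNReal.ofReal_mul (by positivity), ← Real.exp_add]
      ring_nf
    rw [lintegral_congr e, lintegral_mul_const _ (by fun_prop)]
    refine (mul_le_mul_left hH _).trans_eq ?_
    rw [← ENNReal.ofReal_mul (by positivity), ← Real.exp_add]
    ring_nf
    simp
  refine (lintegral_mono h).trans_eq ?_
  simp

/-! ### CVaR estimators lie between the extreme samples -/

theorem le_orderStat {n k : ℕ} (hk : 1 ≤ k) (hkn : k ≤ n) {r : Fin n → ℝ} {x : ℝ}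
    (hx : ∀ i, x ≤ r i) : x ≤ orderStat k r := by
  have hn : (Finset.univ : Finset (Fin n)).Nonempty :=
    Finset.univ_nonempty_iff.2 ⟨⟨0, by omega⟩⟩
  refine le_csInf ⟨Finset.univ.sup' hn r, ?_⟩ fun y hy => ?_
  · have : (Finset.univ.filter fun i => r i ≤ Finset.univ.sup' hn r) = Finset.univ :=
      Finset.filter_true_of_mem fun i _ => Finset.le_sup' r (Finset.mem_univ i)
    rw [Set.mem_ofPred_eq, this]
    simpa using hkn
  · have hpos : 0 < (Finset.univ.filter fun i => r i ≤ y).card := lt_of_lt_of_le hk hy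
    obtain ⟨i, hi⟩ := Finset.card_pos.1 hpos
    exact (hx i).trans (Finset.mem_filter.1 hi).2

theorem orderStat_le {n k : ℕ} (hk : 1 ≤ k) (hkn : k ≤ n) {r : Fin n → ℝ} {x : ℝ}
    (hx : ∀ i, r i ≤ x) : orderStat k r ≤ x := by
  have hn : (Finset.univ : Finset (Fin n)).Nonempty :=
    Finset.univ_nonempty_iff.2 ⟨⟨0, by omega⟩⟩
  refine csInf_le ⟨Finset.univ.inf' hn r, fun y hy => ?_⟩ ?_
  · have hpos : 0 < (Finset.univ.filter fun i => r i ≤ y).card := lt_of_lt_of_le hk hy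
    obtain ⟨i, hi⟩ := Finset.card_pos.1 hpos
    exact (Finset.inf'_le r (Finset.mem_univ i)).trans (Finset.mem_filter.1 hi).2
  · have : (Finset.univ.filter fun i => r i ≤ x) = Finset.univ :=
      Finset.filter_true_of_mem fun i _ => hx i
    rw [Set.mem_ofPred_eq, this]
    simpa using hkn

theorem one_le_sampleSize {α : ℝ} (hα₁ : α < 1) : 1 ≤ sampleSize α :=
  Nat.ceil_pos.2 (by have : 0 < 1 - α := by linarith
                     positivity)

theorem two_le_sampleSize {α : ℝ} (hα₀ : 0 ≤ α) (hα₁ : α < 1)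
    (h : ¬∃ m : ℤ, 1 / (1 - α) = (m : ℝ)) : 2 ≤ sampleSize α := by
  have h1 : 1 ≤ 1 / (1 - α) := by
    rw [le_div_iff₀ (by linarith)]; linarith
  have h2 : 1 < 1 / (1 - α) := lt_of_le_of_ne h1 fun h' => h ⟨1, by simpa using h'.symm⟩
  exact Nat.lt_ceil.2 (by simpa using h2)

theorem mcCVaR_term_le {α : ℝ} (hα₀ : 0 ≤ α) (hα₁ : α < 1) {r : Fin (sampleSize α) → ℝ} {x : ℝ}
    (hx : ∀ i, r i ≤ x) (y : ℝ) :
    y - 1 / ((sampleSize α : ℝ) * (1 - α)) * ∑ i, max (y - r i) 0 ≤ x := by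
  have hn : (0 : ℝ) < sampleSize α := by exact_mod_cast one_le_sampleSize hα₁
  have h1α : 0 < 1 - α := by linarith
  have hsum : (sampleSize α : ℝ) * max (y - x) 0 ≤ ∑ i, max (y - r i) 0 := by
    have := Finset.card_nsmul_le_sum Finset.univ (fun i => max (y - r i) 0) (max (y - x) 0)
      fun i _ => max_le_max (by linarith [hx i]) le_rfl
    simpa using this
  have h2 : max (y - x) 0 ≤ 1 / ((sampleSize α : ℝ) * (1 - α)) * ∑ i, max (y - r i) 0 := by
    rw [one_div, inv_mul_eq_div, le_div_iff₀ (by positivity)]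
    refine le_trans ?_ hsum
    have : 0 ≤ max (y - x) 0 := le_max_right _ _
    nlinarith [mul_nonneg this (mul_nonneg hn.le hα₀)]
  linarith [le_max_left (y - x) 0]

/-- `C r` lies between the smallest and the largest of the samples `r`. Nothing else about the
estimators of CVaR matters for the regret. -/
structure IsSandwiched {n : ℕ} (C : (Fin n → ℝ) → ℝ) : Prop where
  le_of_forall_le : ∀ (r : Fin n → ℝ) (x : ℝ), (∀ i, x ≤ r i) → x ≤ C r
  of_forall_le : ∀ (r : Fin n → ℝ) (x : ℝ), (∀ i, r i ≤ x) → C r ≤ x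

theorem isSandwiched_mcCVaR {α : ℝ} (hα₀ : 0 ≤ α) (hα₁ : α < 1) :
    IsSandwiched (mcCVaR α (n := sampleSize α)) where
  le_of_forall_le r x hx := by
    have hn : (Finset.univ : Finset (Fin (sampleSize α))).Nonempty :=
      Finset.univ_nonempty_iff.2 ⟨⟨0, one_le_sampleSize hα₁⟩⟩
    have h := le_ciSup (f := fun y : ℝ =>
      (y - 1 / ((sampleSize α : ℝ) * (1 - α)) * ∑ i, max (y - r i) 0))
      ⟨Finset.univ.sup' hn r, by
        rintro _ ⟨y, rfl⟩
        exact mcCVaR_term_le hα₀ hα₁ (fun i => Finset.le_sup' r (Finset.mem_univ i)) y⟩ x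
    refine le_trans (le_of_eq ?_) h
    have : ∀ i, max (x - r i) 0 = 0 := fun i => max_eq_right (by linarith [hx i])
    simp [this]
  of_forall_le r x hx := ciSup_le fun y => mcCVaR_term_le hα₀ hα₁ hx y

theorem isSandwiched_modCVaR {α : ℝ} (hα₀ : 0 ≤ α) (hα₁ : α < 1) :
    IsSandwiched (modCVaR α (n := sampleSize α)) where
  le_of_forall_le r x hx := by
    unfold modCVaR
    split_ifs with h
    · exact le_orderStat le_rfl (one_le_sampleSize hα₁) hx
    · exact le_orderStat one_le_two (two_le_sampleSize hα₀ hα₁ h) hx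
  of_forall_le r x hx := by
    unfold modCVaR
    split_ifs with h
    · exact orderStat_le le_rfl (one_le_sampleSize hα₁) hx
    · exact orderStat_le one_le_two (two_le_sampleSize hα₀ hα₁ h) hx

/-! ### Measurability of the posterior parameters -/

section Measurability

variable {Ω : Type*} {m : MeasurableSpace Ω} {d K : ℕ} {s : ℕ → Ω → EuclideanSpace ℝ (Fin d)}
  {a : ℕ → Ω → Fin K} {R : ℕ → Ω → ℝ} {t : ℕ}

theorem measurable_ofLp_apply {f : Ω → EuclideanSpace ℝ (Fin d)} (hf : Measurable f) (i : Fin d) :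
    Measurable fun ω => (f ω).ofLp i := by
  have : Measurable fun x : EuclideanSpace ℝ (Fin d) => x.ofLp i := by fun_prop
  exact this.comp hf

theorem measurable_expReward (θ : Fin K → EuclideanSpace ℝ (Fin d))
    {f : Ω → EuclideanSpace ℝ (Fin d)} (hf : Measurable f) (b : Fin K) :
    Measurable fun ω => expReward θ (f ω) b := by
  unfold expReward dotProduct
  exact Finset.measurable_sum _ fun i _ => (measurable_ofLp_apply hf i).mul_const _

theorem measurable_det {ι : Type*} [Fintype ι] [DecidableEq ι] {M : Ω → Matrix ι ι ℝ}
    (hM : ∀ i j, Measurable fun ω => M ω i j) : Measurable fun ω => (M ω).det := by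
  simp only [Matrix.det_apply']
  exact Finset.measurable_sum _ fun σ _ =>
    (Finset.measurable_prod _ fun i _ => hM _ _).const_mul _

theorem measurable_inv_apply {ι : Type*} [Fintype ι] [DecidableEq ι] {M : Ω → Matrix ι ι ℝ}
    (hM : ∀ i j, Measurable fun ω => M ω i j) (i j : ι) : Measurable fun ω => (M ω)⁻¹ i j := by
  simp only [Matrix.inv_def, Ring.inverse_eq_inv', Matrix.smul_apply, smul_eq_mul,
    Matrix.adjugate_apply]
  refine (measurable_det hM).inv.mul (measurable_det fun k l => ?_)
  simp only [Matrix.updateRow_apply]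
  split_ifs
  · exact measurable_const
  · exact hM k l

theorem measurable_sum_filter (ha : ∀ τ ∈ Finset.Ico 1 t, Measurable (a τ)) (b : Fin K)
    {f : ℕ → Ω → ℝ} (hf : ∀ τ ∈ Finset.Ico 1 t, Measurable (f τ)) :
    Measurable fun ω => ∑ τ ∈ (Finset.Ico 1 t).filter (fun τ => a τ ω = b), f τ ω := by
  simp only [Finset.sum_filter]
  exact Finset.measurable_sum _ fun τ hτ =>
    Measurable.ite (ha τ hτ (measurableSet_singleton b)) (hf τ hτ) measurable_const

theorem measurable_precision (hs : ∀ τ ∈ Finset.Ico 1 t, Measurable (s τ))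
    (ha : ∀ τ ∈ Finset.Ico 1 t, Measurable (a τ)) (b : Fin K) (i j : Fin d) :
    Measurable fun ω => precision (fun τ => s τ ω) (fun τ => a τ ω) t b i j := by
  simp only [precision, Matrix.add_apply, Matrix.sum_apply, Matrix.vecMulVec_apply]
  exact (measurable_sum_filter ha b fun τ hτ =>
    (measurable_ofLp_apply (hs τ hτ) i).mul (measurable_ofLp_apply (hs τ hτ) j)).const_add _

theorem measurable_postVar (hs : ∀ τ ∈ Finset.Ico 1 t, Measurable (s τ)) (hst : Measurable (s t))
    (ha : ∀ τ ∈ Finset.Ico 1 t, Measurable (a τ)) (b : Fin K) :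
    Measurable fun ω => postVar (fun τ => s τ ω) (fun τ => a τ ω) t b := by
  unfold postVar dotProduct Matrix.mulVec dotProduct
  exact Finset.measurable_sum _ fun i _ => (measurable_ofLp_apply hst i).mul <|
    Finset.measurable_sum _ fun j _ => (measurable_inv_apply
      (measurable_precision hs ha b) i j).mul (measurable_ofLp_apply hst j)

theorem measurable_prediction (hs : ∀ τ ∈ Finset.Ico 1 t, Measurable (s τ))
    (hst : Measurable (s t)) (ha : ∀ τ ∈ Finset.Ico 1 t, Measurable (a τ))
    (hR : ∀ τ ∈ Finset.Ico 1 t, Measurable (R τ)) (b : Fin K) :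
    Measurable fun ω => (s t ω).ofLp ⬝ᵥ
      estimate (fun τ => s τ ω) (fun τ => a τ ω) (fun τ => R τ ω) t b := by
  unfold estimate Matrix.mulVec dotProduct
  simp only [Finset.sum_apply, Pi.smul_apply, smul_eq_mul]
  exact Finset.measurable_sum _ fun i _ => (measurable_ofLp_apply hst i).mul <|
    Finset.measurable_sum _ fun j _ => (measurable_inv_apply
      (measurable_precision hs ha b) i j).mul <|
    measurable_sum_filter ha b fun τ hτ => (hR τ hτ).mul (measurable_ofLp_apply (hs τ hτ) j)

end Measurability

/-! ### Confidence bounds for the estimated rewards -/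

section Rewards

variable {d K : ℕ} {θ : Fin K → EuclideanSpace ℝ (Fin d)}
  {Q : Fin K → Kernel (EuclideanSpace ℝ (Fin d)) ℝ}

theorem BoundedLinearRewards.expReward_mem [∀ a, IsMarkovKernel (Q a)]
    (hQ : BoundedLinearRewards θ Q) {x : EuclideanSpace ℝ (Fin d)} (hx : x ∈ contextSpace d)
    (b : Fin K) : expReward θ x b ∈ Set.Icc (0 : ℝ) 1 := by
  rw [← hQ.mean_eq x hx b]
  have h := hQ.mem_unit x hx b
  refine ⟨integral_nonneg_of_ae (h.mono fun y hy => hy.1), ?_⟩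
  have hi : Integrable (fun y : ℝ => y) (Q b x) :=
    Integrable.of_mem_Icc 0 1 (by fun_prop) h
  have := integral_mono_ae hi (integrable_const (1 : ℝ)) (h.mono fun y hy => hy.2)
  simpa using this

/-- Since the contexts fill the positive part of the unit ball, rewards in `[0, 1]` force the
parameters into the unit ball. -/
theorem BoundedLinearRewards.norm_le_one [∀ a, IsMarkovKernel (Q a)]
    (hQ : BoundedLinearRewards θ Q) (b : Fin K) : ‖θ b‖ ≤ 1 := by
  have hnn : ∀ i, 0 ≤ θ b i := by
    intro i
    have he : EuclideanSpace.single i (1 : ℝ) ∈ contextSpace d := by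
      refine ⟨fun j => ?_, by simp⟩
      simp only [PiLp.single_apply]
      split_ifs <;> norm_num
    have := (hQ.expReward_mem he b).1
    simpa [expReward, dotProduct, Pi.single_apply] using this
  by_cases h0 : ‖θ b‖ = 0
  · rw [h0]; norm_num
  have hx : ‖θ b‖⁻¹ • θ b ∈ contextSpace d := by
    refine ⟨fun i => ?_, ?_⟩
    · have := hnn i
      simp only [PiLp.smul_apply, smul_eq_mul]
      positivity
    · rw [norm_smul, norm_inv, norm_norm, inv_mul_cancel₀ h0]
  have h := (hQ.expReward_mem hx b).2
  rw [expReward, WithLp.ofLp_smul, smul_dotProduct, dotProduct_ofLp_self, smul_eq_mul, sq,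
    inv_mul_cancel_left₀ h0] at h
  exact h

end Rewards

section ErrIncrement

variable {Ω : Type*} {d K : ℕ} {θ : Fin K → EuclideanSpace ℝ (Fin d)}
  {s : ℕ → Ω → EuclideanSpace ℝ (Fin d)} {a : ℕ → Ω → Fin K} {R : ℕ → Ω → ℝ}

/-- The change of the error potential of arm `b` in round `t + 1`. -/
noncomputable def errIncrement (θ : Fin K → EuclideanSpace ℝ (Fin d))
    (s : ℕ → Ω → EuclideanSpace ℝ (Fin d)) (a : ℕ → Ω → Fin K) (R : ℕ → Ω → ℝ) (b : Fin K)
    (t : ℕ) (ω : Ω) : ℝ :=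
  if a (t + 1) ω = b then
    errFactor (postVar (fun τ => s τ ω) (fun τ => a τ ω) (t + 1) b)
      ((s (t + 1) ω).ofLp ⬝ᵥ
        estimate (fun τ => s τ ω) (fun τ => a τ ω) (fun τ => R τ ω) (t + 1) b
          - expReward θ (s (t + 1) ω) b)
      (R (t + 1) ω - expReward θ (s (t + 1) ω) b)
  else 1

theorem errPotential_eq_prod (b : Fin K) (t : ℕ) (ω : Ω) :
    errPotential (fun τ => s τ ω) (fun τ => a τ ω) (fun τ => R τ ω) θ (t + 1) b =
      Real.exp (2 * ‖θ b‖ ^ 2) * ∏ τ ∈ Finset.range t, errIncrement θ s a R b τ ω := by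
  induction t with
  | zero => simp [errPotential_one]
  | succ t ih =>
    rw [errPotential_succ _ _ _ _ (by omega), ih, Finset.prod_range_succ, ← mul_assoc]
    rfl

end ErrIncrement

section Run

variable {Ω : Type*} [mΩ : MeasurableSpace Ω] {P : Measure Ω}
  {d K n T : ℕ} {δ : ℝ} {C : (Fin n → ℝ) → ℝ} {θ : Fin K → EuclideanSpace ℝ (Fin d)}
  {Q : Fin K → Kernel (EuclideanSpace ℝ (Fin d)) ℝ}
  {pre post : Filtration ℕ mΩ}
  {s : ℕ → Ω → EuclideanSpace ℝ (Fin d)} {r : ℕ → Ω → Fin K → Fin n → ℝ}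
  {a : ℕ → Ω → Fin K} {R : ℕ → Ω → ℝ}

theorem IsRun.past_meas (h : IsRun P T δ C Q pre post s r a R) {t : ℕ} (ht : t ≤ T) :
    ∀ τ ∈ Finset.Ico 1 t,
      Measurable[pre t] (s τ) ∧ Measurable[pre t] (a τ) ∧ Measurable[pre t] (R τ) := by
  intro τ hτ
  have h1 := Finset.mem_Ico.1 hτ
  have hτT : τ ∈ Finset.Icc 1 T := Finset.mem_Icc.2 ⟨h1.1, by omega⟩
  have hle : pre (τ + 1) ≤ pre t := pre.mono (by omega)
  exact ⟨(h.context_meas τ hτT).mono (pre.mono h1.2.le) le_rfl,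
    (h.arm_meas τ hτT).mono ((h.post_le_pre τ).trans hle) le_rfl,
    (h.reward_meas τ hτT).mono hle le_rfl⟩

theorem IsRun.postVar_meas (h : IsRun P T δ C Q pre post s r a R) {t : ℕ}
    (ht : t ∈ Finset.Icc 1 T) (b : Fin K) :
    Measurable[pre t] fun ω => postVar (fun τ => s τ ω) (fun τ => a τ ω) t b :=
  have hp := h.past_meas (Finset.mem_Icc.1 ht).2
  measurable_postVar (fun τ hτ => (hp τ hτ).1) (h.context_meas t ht) (fun τ hτ => (hp τ hτ).2.1) b

theorem IsRun.prediction_meas (h : IsRun P T δ C Q pre post s r a R) {t : ℕ}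
    (ht : t ∈ Finset.Icc 1 T) (b : Fin K) :
    Measurable[pre t] fun ω => (s t ω).ofLp ⬝ᵥ
      estimate (fun τ => s τ ω) (fun τ => a τ ω) (fun τ => R τ ω) t b :=
  have hp := h.past_meas (Finset.mem_Icc.1 ht).2
  measurable_prediction (fun τ hτ => (hp τ hτ).1) (h.context_meas t ht)
    (fun τ hτ => (hp τ hτ).2.1) (fun τ hτ => (hp τ hτ).2.2) b

theorem measurable_errFactor :
    Measurable fun p : ℝ × ℝ × ℝ => errFactor p.1 p.2.1 p.2.2 := by
  unfold errFactor
  fun_prop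

/-- The σ-algebras `pre (t + 1)`, for rounds counted from zero. -/
def shift (𝓕 : Filtration ℕ mΩ) : Filtration ℕ mΩ where
  seq t := 𝓕 (t + 1)
  mono' _ _ h := 𝓕.mono (Nat.succ_le_succ h)
  le' t := 𝓕.le (t + 1)

theorem IsRun.errIncrement_meas (h : IsRun P T δ C Q pre post s r a R) (b : Fin K)
    {t : ℕ} (ht : t < T) : Measurable[pre (t + 2)] (errIncrement θ s a R b t) := by
  have htT : t + 1 ∈ Finset.Icc 1 T := Finset.mem_Icc.2 ⟨by omega, ht⟩
  have hle : pre (t + 1) ≤ pre (t + 2) := pre.mono (by omega)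
  have hw := (h.postVar_meas htT b).mono hle le_rfl
  have hμ := (h.prediction_meas htT b).mono hle le_rfl
  have hρ := (measurable_expReward θ (h.context_meas _ htT) b).mono hle le_rfl
  have ha := (h.arm_meas _ htT).mono (h.post_le_pre _) le_rfl
  refine Measurable.ite (ha (measurableSet_singleton b)) ?_ measurable_const
  exact measurable_errFactor.comp
    (hw.prodMk ((hμ.sub hρ).prodMk ((h.reward_meas _ htT).sub hρ)))

variable [IsProbabilityMeasure P]

theorem IsRun.lintegral_errIncrement_le [∀ a, IsMarkovKernel (Q a)]
    (hQ : BoundedLinearRewards θ Q) (h : IsRun P T δ C Q pre post s r a R) (b : Fin K)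
    {t : ℕ} (ht : t < T) {G : Ω → ENNReal} (hG : Measurable[pre (t + 1)] G) :
    ∫⁻ ω, G ω * ENNReal.ofReal (errIncrement θ s a R b t ω) ∂P ≤ ∫⁻ ω, G ω ∂P := by
  have htT : t + 1 ∈ Finset.Icc 1 T := Finset.mem_Icc.2 ⟨by omega, ht⟩
  have hpp := h.pre_le_post (t + 1)
  have hw := (h.postVar_meas htT b).mono hpp le_rfl
  have hμ := (h.prediction_meas htT b).mono hpp le_rfl
  have hρ := (measurable_expReward θ (h.context_meas _ htT) b).mono hpp le_rfl
  let X : Ω → ENNReal × Fin K × ℝ × ℝ × ℝ := fun ω =>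
    (G ω, a (t + 1) ω, postVar (fun τ => s τ ω) (fun τ => a τ ω) (t + 1) b,
      (s (t + 1) ω).ofLp ⬝ᵥ
        estimate (fun τ => s τ ω) (fun τ => a τ ω) (fun τ => R τ ω) (t + 1) b
          - expReward θ (s (t + 1) ω) b, expReward θ (s (t + 1) ω) b)
  have hX : Measurable[post (t + 1)] X := (hG.mono hpp le_rfl).prodMk
    ((h.arm_meas _ htT).prodMk (hw.prodMk ((hμ.sub hρ).prodMk hρ)))
  let f : (ENNReal × Fin K × ℝ × ℝ × ℝ) × ℝ → ENNReal := fun p =>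
    p.1.1 * ENNReal.ofReal
      (if p.1.2.1 = b then errFactor p.1.2.2.1 p.1.2.2.2.1 (p.2 - p.1.2.2.2.2) else 1)
  have hf : Measurable f := by
    refine Measurable.mul (by fun_prop) (Measurable.ennreal_ofReal (Measurable.ite ?_ ?_ ?_))
    · exact (by fun_prop : Measurable fun p : (ENNReal × Fin K × ℝ × ℝ × ℝ) × ℝ => p.1.2.1)
        (measurableSet_singleton b)
    · exact measurable_errFactor.comp (by fun_prop :
        Measurable fun p : (ENNReal × Fin K × ℝ × ℝ × ℝ) × ℝ =>
          (p.1.2.2.1, p.1.2.2.2.1, p.2 - p.1.2.2.2.2))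
    · exact measurable_const
  have hR : Measurable (R (t + 1)) := (h.reward_meas _ htT).mono (pre.le _) le_rfl
  have key := ((h.reward_law _ htT).lintegral_eq (post.le _) hX hR hf).2
  refine key.trans_le (lintegral_mono_ae ?_)
  filter_upwards [h.context_mem _ htT] with ω hω
  simp only [f, X]
  split_ifs with hab
  · have h1 := lintegral_errFactor_le (hQ.mem_unit _ hω (a (t + 1) ω))
      (postVar_nonneg (fun τ => s τ ω) (fun τ => a τ ω) (t + 1) b)
      ((s (t + 1) ω).ofLp ⬝ᵥ
        estimate (fun τ => s τ ω) (fun τ => a τ ω) (fun τ => R τ ω) (t + 1) b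
          - expReward θ (s (t + 1) ω) b)
    rw [hQ.mean_eq _ hω, hab] at h1
    rw [hab, lintegral_const_mul]
    · exact mul_le_of_le_one_right' h1
    · exact (measurable_errFactor.comp (by fun_prop : Measurable fun y : ℝ =>
        (postVar (fun τ => s τ ω) (fun τ => a τ ω) (t + 1) b, (s (t + 1) ω).ofLp ⬝ᵥ
        estimate (fun τ => s τ ω) (fun τ => a τ ω) (fun τ => R τ ω) (t + 1) b
          - expReward θ (s (t + 1) ω) b, y - expReward θ (s (t + 1) ω) b))).ennreal_ofReal
  · simp

theorem errFactor_nonneg (w m η : ℝ) : 0 ≤ errFactor w m η :=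
  mul_nonneg (inv_nonneg.2 (Real.sqrt_nonneg _)) (Real.exp_pos _).le

/-- With high probability, the error potentials of all the arms stay bounded. -/
theorem IsRun.measure_errPotential_ge_le [∀ a, IsMarkovKernel (Q a)]
    (hQ : BoundedLinearRewards θ Q) (h : IsRun P T δ C Q pre post s r a R) {ε : ℝ} (hε : 0 < ε) :
    P {ω | ∃ b, ∃ t ≤ T, Real.exp 2 * (K / ε) ≤
      errPotential (fun τ => s τ ω) (fun τ => a τ ω) (fun τ => R τ ω) θ (t + 1) b} ≤
      ENNReal.ofReal ε := by
  rcases Nat.eq_zero_or_pos K with rfl | hK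
  · simp
  have hK' : (0 : ℝ) < K := by exact_mod_cast hK
  have hb : ∀ b, P {ω | ∃ t ≤ T, Real.exp 2 * (K / ε) ≤
      errPotential (fun τ => s τ ω) (fun τ => a τ ω) (fun τ => R τ ω) θ (t + 1) b} ≤
      ENNReal.ofReal (ε / K) := by
    intro b
    have hv := measure_exists_le_prod_le P (shift pre) T (ENNReal.ofReal (K / ε))
      (by simpa using div_pos hK' hε) ENNReal.ofReal_ne_top
      (fun t ω => ENNReal.ofReal (errIncrement θ s a R b t ω))
      (fun t ht => (h.errIncrement_meas b ht).ennreal_ofReal)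
      (fun t ht G hG => h.lintegral_errIncrement_le hQ b ht hG)
    rw [← ENNReal.ofReal_inv_of_pos (by positivity), inv_div] at hv
    refine (measure_mono ?_).trans hv
    rintro ω ⟨t, ht, hω⟩
    refine ⟨t, ht, ?_⟩
    rw [← ENNReal.ofReal_prod_of_nonneg]
    · refine ENNReal.ofReal_le_ofReal ?_
      rw [errPotential_eq_prod] at hω
      have hθ : Real.exp (2 * ‖θ b‖ ^ 2) ≤ Real.exp 2 := by
        have := hQ.norm_le_one b
        have h0 := norm_nonneg (θ b)
        gcongr
        nlinarith
      have h1 : Real.exp (2 * ‖θ b‖ ^ 2) * (K / ε) ≤ Real.exp 2 * (K / ε) := by gcongr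
      exact le_of_mul_le_mul_left (h1.trans hω) (Real.exp_pos _)
    · intro τ _
      unfold errIncrement
      split_ifs
      · exact errFactor_nonneg _ _ _
      · exact zero_le_one
  have hset : {ω | ∃ b, ∃ t ≤ T, Real.exp 2 * (K / ε) ≤
      errPotential (fun τ => s τ ω) (fun τ => a τ ω) (fun τ => R τ ω) θ (t + 1) b} =
      ⋃ b, {ω | ∃ t ≤ T, Real.exp 2 * (K / ε) ≤
      errPotential (fun τ => s τ ω) (fun τ => a τ ω) (fun τ => R τ ω) θ (t + 1) b} := by
    ext; simp
  rw [hset]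
  refine (measure_iUnion_le _).trans ?_
  rw [tsum_fintype]
  refine (Finset.sum_le_sum fun b _ => hb b).trans_eq ?_
  rw [Finset.sum_const, Finset.card_univ, Fintype.card_fin, nsmul_eq_mul,
    ← ENNReal.ofReal_natCast, ← ENNReal.ofReal_mul hK'.le]
  congr 1
  field_simp

/-- The confidence bound in units of the sampling scale: the true reward is within `4 / 3` sampling
standard deviations of its prediction, since `(4 / 3) ν_t = √(d log (4 t / δ))`. The rounds `t < K`
are left out to absorb the `log K` of the union bound over the arms, and the rounds `t < 14` to have
`log (4 t / δ) ≥ 4`, which absorbs the additive constants. -/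
theorem abs_prediction_sub_le {s : ℕ → EuclideanSpace ℝ (Fin d)} {a : ℕ → Fin K} {R : ℕ → ℝ}
    {t : ℕ} (hd : 1 ≤ d) (hδ₀ : 0 < δ) (hδ₁ : δ ≤ 1) (ht : 14 ≤ t) (htK : K ≤ t)
    (hs : ∀ τ ∈ Finset.Ico 1 t, ‖s τ‖ ≤ 1) (b : Fin K)
    (hA : errPotential s a R θ t b ≤ Real.exp 2 * (K / (δ / 2))) :
    |(s t).ofLp ⬝ᵥ estimate s a R t b - expReward θ (s t) b| ≤
      4 / 3 * (samplingScale d δ t * √(postVar s a t b)) := by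
  have ht' : (14 : ℝ) ≤ t := by exact_mod_cast ht
  have htK' : (K : ℝ) ≤ t := by exact_mod_cast htK
  have hd' : (1 : ℝ) ≤ d := by exact_mod_cast hd
  have hK : (0 : ℝ) < K := by exact_mod_cast b.pos
  have h1 := sq_predictionError_le s a R θ b hA
  have h2 := log_det_precision_le s a (by omega) hs b
  have hlogt : Real.log t ≤ Real.log (4 * t / δ) := by
    refine Real.log_le_log (by linarith) ?_
    rw [le_div_iff₀ hδ₀]; nlinarith
  have hlogK : Real.log (K / (δ / 2)) ≤ Real.log (4 * t / δ) := by
    refine Real.log_le_log (by positivity) ?_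
    rw [div_div_eq_mul_div]
    exact div_le_div_of_nonneg_right (by linarith) hδ₀.le
  have hlog4 : 4 ≤ Real.log (4 * t / δ) := by
    rw [Real.le_log_iff_exp_le (by positivity)]
    have he : Real.exp 4 ≤ 56 := by
      have h := Real.exp_one_lt_d9
      have : Real.exp 4 = Real.exp 1 ^ 4 := by rw [← Real.exp_nat_mul]; norm_num
      rw [this]
      calc Real.exp 1 ^ 4 ≤ 2.7182818286 ^ 4 := by gcongr
        _ ≤ 56 := by norm_num
    rw [le_div_iff₀ hδ₀]
    nlinarith [Real.exp_pos 4]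
  rw [Real.log_mul (Real.exp_pos _).ne' (by positivity), Real.log_exp] at h1
  set L := Real.log (4 * t / δ) with hL
  have h3 : (2 + Real.log (K / (δ / 2))) / 2 + Real.log (precision s a t b).det / 4 ≤ d * L := by
    nlinarith
  have hw := postVar_nonneg s a t b
  refine abs_le_of_sq_le_sq ?_ (by unfold samplingScale; positivity)
  refine h1.trans ?_
  have e : (4 / 3 * (samplingScale d δ t * √(postVar s a t b))) ^ 2 =
      postVar s a t b * (d * L) := by
    rw [samplingScale, ← hL]
    have := Real.sq_sqrt hw
    have h5 := Real.sq_sqrt (show 0 ≤ d * L by positivity)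
    calc _ = √(d * L) ^ 2 * √(postVar s a t b) ^ 2 := by ring
      _ = _ := by rw [this, h5]; ring
  rw [e]
  gcongr

end Run

/-! ### One round of posterior sampling -/

section Round

variable {K n : ℕ}

/-- The law of the samples of one round: independent Gaussians, with mean `μ b` and standard
deviation `ν √(w b)` for arm `b`. -/
noncomputable def samplesLaw (n : ℕ) (ν : ℝ) (μ w : Fin K → ℝ) : Measure (Fin K → Fin n → ℝ) :=
  Measure.pi fun b => Measure.pi fun _ : Fin n => gaussianReal (μ b) (ν ^ 2 * w b).toNNReal

instance (ν : ℝ) (μ w : Fin K → ℝ) : IsProbabilityMeasure (samplesLaw n ν μ w) := by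
  unfold samplesLaw; infer_instance

/-- The true rewards lie within `4 / 3` sampling standard deviations of the predictions. -/
def Confident (ν : ℝ) (ρ μ w : Fin K → ℝ) : Prop :=
  ∀ b, |μ b - ρ b| ≤ 4 / 3 * (ν * √(w b))

/-- Some sample is more than `g` standard deviations away from its mean. -/
def Outlying (g ν : ℝ) (μ w : Fin K → ℝ) (y : Fin K → Fin n → ℝ) : Prop :=
  ∃ b i, g * (ν * √(w b)) < |y b i - μ b|

/-- No sample of some optimal arm falls short of its true reward. -/
def Optimistic (ρ : Fin K → ℝ) (y : Fin K → Fin n → ℝ) : Prop :=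
  ∃ b, (∀ b', ρ b' ≤ ρ b) ∧ ∀ i, ρ b ≤ y b i

/-- The smallest posterior deviation `√(w b)` of an unsaturated arm, that is one whose gap is at
most `W √(w b)`. Saturated arms enter with the value `1`, an upper bound of all the deviations. -/
noncomputable def minWidth (W : ℝ) (ρ w : Fin K → ℝ) : ℝ :=
  ⨅ b, if (⨆ b', ρ b') - ρ b ≤ W * √(w b) then √(w b) else 1

open Classical in
/-- The part of the regret of a round that is not paid for by the posterior deviation of the pulled
arm. Its conditional mean is at most zero when the samples are outlying with probability at most
`β`, and optimistic without being outlying with probability at least `q`. -/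
noncomputable def surplus (W g ν β q : ℝ) (ρ μ w : Fin K → ℝ) (y : Fin K → Fin n → ℝ) : ℝ :=
  (if Outlying g ν μ w y then 1 else 0) - β +
    2 * W * minWidth W ρ w * (1 - (if Optimistic ρ y ∧ ¬Outlying g ν μ w y then 1 else 0) / q)

section Measurability

variable {X : Type*} [MeasurableSpace X] {ρ μ w : X → Fin K → ℝ} {y : X → Fin K → Fin n → ℝ}

theorem measurableSet_outlying (g ν : ℝ) (hμ : Measurable μ) (hw : Measurable w)
    (hy : Measurable y) : MeasurableSet {x | Outlying g ν (μ x) (w x) (y x)} := by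
  unfold Outlying
  simp only [Set.ofPred_exists]
  exact .iUnion fun b => .iUnion fun i => measurableSet_lt (by fun_prop) (by fun_prop)

theorem measurableSet_optimistic (hρ : Measurable ρ) (hy : Measurable y) :
    MeasurableSet {x | Optimistic (ρ x) (y x)} := by
  unfold Optimistic
  simp only [Set.ofPred_exists, Set.ofPred_and, Set.ofPred_forall]
  exact .iUnion fun b => (MeasurableSet.iInter fun b' =>
    measurableSet_le (by fun_prop) (by fun_prop)).inter
      (.iInter fun i => measurableSet_le (by fun_prop) (by fun_prop))

theorem measurableSet_confident (ν : ℝ) (hρ : Measurable ρ) (hμ : Measurable μ)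
    (hw : Measurable w) : MeasurableSet {x | Confident ν (ρ x) (μ x) (w x)} := by
  unfold Confident
  simp only [Set.ofPred_forall]
  exact .iInter fun b => measurableSet_le (by fun_prop) (by fun_prop)

theorem measurable_minWidth (W : ℝ) (hρ : Measurable ρ) (hw : Measurable w) :
    Measurable fun x => minWidth W (ρ x) (w x) := by
  unfold minWidth
  refine Measurable.iInf fun b => Measurable.ite (measurableSet_le ?_ (by fun_prop)) (by fun_prop)
    measurable_const
  exact (Measurable.iSup fun b' => by fun_prop).sub (by fun_prop)

theorem measurable_surplus (W g ν β q : ℝ) (hρ : Measurable ρ) (hμ : Measurable μ)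
    (hw : Measurable w) (hy : Measurable y) :
    Measurable fun x => surplus W g ν β q (ρ x) (μ x) (w x) (y x) := by
  have h1 := measurableSet_outlying g ν hμ hw hy
  have h2 := measurableSet_optimistic hρ hy
  have h3 := measurable_minWidth W hρ hw
  unfold surplus
  exact ((Measurable.ite h1 measurable_const measurable_const).sub_const _).add
    ((h3.const_mul _).mul (((Measurable.ite (h2.inter h1.compl) measurable_const
      measurable_const).div_const _).const_sub _))

end Measurability

theorem minWidth_mem [NeZero K] (W : ℝ) (ρ w : Fin K → ℝ) (hw : ∀ b, w b ≤ 1) :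
    minWidth W ρ w ∈ Set.Icc (0 : ℝ) 1 := by
  constructor
  · refine le_ciInf fun b => ?_
    split_ifs <;> positivity
  · refine (ciInf_le (Set.finite_range _).bddBelow (0 : Fin K)).trans ?_
    split_ifs
    · exact Real.sqrt_le_one.2 (hw 0)
    · exact le_rfl

theorem minWidth_le (W : ℝ) (ρ w : Fin K → ℝ) {b : Fin K}
    (hb : (⨆ b', ρ b') - ρ b ≤ W * √(w b)) : minWidth W ρ w ≤ √(w b) := by
  refine (ciInf_le (Set.finite_range _).bddBelow b).trans ?_
  rw [if_pos hb]

theorem exists_eq_iSup [NeZero K] (ρ : Fin K → ℝ) : ∃ b, ρ b = ⨆ b', ρ b' := by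
  obtain ⟨b, hb⟩ := Finite.exists_max ρ
  exact ⟨b, le_antisymm (le_ciSup (Set.finite_range ρ).bddAbove b) (ciSup_le hb)⟩

/-- The minimum is attained at an unsaturated arm, since optimal arms are unsaturated. -/
theorem exists_minWidth_eq [NeZero K] {W : ℝ} (hW : 0 ≤ W) (ρ w : Fin K → ℝ)
    (hw : ∀ b, w b ≤ 1) :
    ∃ b, (⨆ b', ρ b') - ρ b ≤ W * √(w b) ∧ minWidth W ρ w = √(w b) := by
  obtain ⟨b₁, h₁⟩ := exists_eq_ciInf_of_finite
    (f := fun b => if (⨆ b', ρ b') - ρ b ≤ W * √(w b) then √(w b) else 1)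
  by_cases hb : (⨆ b', ρ b') - ρ b₁ ≤ W * √(w b₁)
  · refine ⟨b₁, hb, ?_⟩
    rw [minWidth, ← h₁, if_pos hb]
  · obtain ⟨b₀, h₀⟩ := exists_eq_iSup ρ
    have hb₀ : (⨆ b', ρ b') - ρ b₀ ≤ W * √(w b₀) := by
      rw [h₀, sub_self]; positivity
    refine ⟨b₀, hb₀, le_antisymm (minWidth_le W ρ w hb₀) ?_⟩
    rw [minWidth, ← h₁, if_neg hb]
    exact Real.sqrt_le_one.2 (hw b₀)

/-- The regret of one round. If the samples are not outlying, the pulled arm competes with the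
unsaturated arm of smallest deviation; if they are also optimistic, the pulled arm is itself
unsaturated, so that its deviation is at least the smallest one. -/
theorem round_regret_le [NeZero K] {C : (Fin n → ℝ) → ℝ} (hC : IsSandwiched C)
    {W g ν β q : ℝ} (hν : 0 ≤ ν) (hg : 0 ≤ g) (hW : (g + 4 / 3) * ν ≤ W)
    (hq : 0 < q) {ρ μ w : Fin K → ℝ} (hρ : ∀ b, ρ b ∈ Set.Icc (0 : ℝ) 1) (hw : ∀ b, w b ≤ 1)
    (hconf : Confident ν ρ μ w) {y : Fin K → Fin n → ℝ} {b : Fin K}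
    (hb : ∀ b', C (y b') ≤ C (y b)) :
    (⨆ b', ρ b') - ρ b ≤
      β + surplus W g ν β q ρ μ w y + (W + 2 * W / q) * √(w b) := by
  have hW0 : 0 ≤ W := le_trans (by positivity) hW
  obtain ⟨hm0, hm1⟩ := minWidth_mem W ρ w hw
  have hsb := Real.sqrt_nonneg (w b)
  have hlast : 0 ≤ (W + 2 * W / q) * √(w b) := by positivity
  by_cases hout : Outlying g ν μ w y
  · obtain ⟨b₀, h₀⟩ := exists_eq_iSup ρ
    have h1 : (⨆ b', ρ b') - ρ b ≤ 1 := by rw [← h₀]; linarith [(hρ b₀).2, (hρ b).1]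
    have h2 : 0 ≤ 2 * W * minWidth W ρ w := by positivity
    simp only [surplus, hout, if_true, not_true_eq_false, and_false, if_false, zero_div, sub_zero,
      mul_one]
    linarith
  have hgood : ∀ b i, |y b i - μ b| ≤ g * (ν * √(w b)) := by
    intro b i
    by_contra h
    exact hout ⟨b, i, not_le.1 h⟩
  have hdist : ∀ b i, |y b i - ρ b| ≤ W * √(w b) := by
    intro b i
    have h1 := hgood b i
    have h2 := hconf b
    have h3 : |y b i - ρ b| ≤ |y b i - μ b| + |μ b - ρ b| := abs_sub_le _ _ _
    have h4 : (g + 4 / 3) * ν * √(w b) ≤ W * √(w b) := by gcongr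
    nlinarith
  have hlow : ∀ b, ρ b - W * √(w b) ≤ C (y b) := fun b =>
    hC.le_of_forall_le _ _ fun i => by linarith [(abs_le.1 (hdist b i)).1]
  have hup : ∀ b, C (y b) ≤ ρ b + W * √(w b) := fun b =>
    hC.of_forall_le _ _ fun i => by linarith [(abs_le.1 (hdist b i)).2]
  obtain ⟨b₁, hb₁, hmin⟩ := exists_minWidth_eq hW0 ρ w hw
  have hcore : (⨆ b', ρ b') - ρ b ≤ 2 * W * minWidth W ρ w + W * √(w b) := by
    rw [hmin]
    linarith [hlow b₁, hup b, hb b₁]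
  have hWq : 2 * W * minWidth W ρ w / q ≤ 2 * W / q * √(w b) ∨ ¬Optimistic ρ y := by
    by_cases hopt : Optimistic ρ y
    · left
      obtain ⟨b₀, hmax, hy⟩ := hopt
      have h₀ : (⨆ b', ρ b') = ρ b₀ :=
        le_antisymm (ciSup_le hmax) (le_ciSup (Set.finite_range ρ).bddAbove b₀)
      have hun : (⨆ b', ρ b') - ρ b ≤ W * √(w b) := by
        rw [h₀]
        linarith [hC.le_of_forall_le _ _ hy, hb b₀, hup b]
      have := minWidth_le W ρ w hun
      rw [div_mul_eq_mul_div]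
      gcongr
    · right; exact hopt
  rcases hWq with h | h
  · by_cases hopt : Optimistic ρ y
    · simp only [surplus, hout, hopt, if_false, not_false_eq_true, and_self, if_true]
      have e : 2 * W * minWidth W ρ w * (1 - 1 / q)
          = 2 * W * minWidth W ρ w - 2 * W * minWidth W ρ w / q := by ring
      rw [e]
      linarith
    · simp only [surplus, hout, hopt, if_false, false_and, zero_div, sub_zero, mul_one]
      have : 0 ≤ 2 * W / q * √(w b) := by positivity
      linarith
  · simp only [surplus, hout, h, if_false, false_and, zero_div, sub_zero, mul_one]
    have : 0 ≤ 2 * W / q * √(w b) := by positivity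
    linarith

theorem samplesLaw_preimage (ν : ℝ) (μ w : Fin K → ℝ) (b : Fin K) {S : Set (Fin n → ℝ)}
    (hS : MeasurableSet S) :
    samplesLaw n ν μ w (Function.eval b ⁻¹' S) =
      Measure.pi (fun _ : Fin n => gaussianReal (μ b) (ν ^ 2 * w b).toNNReal) S :=
  (measurePreserving_eval (fun b => Measure.pi fun _ : Fin n =>
    gaussianReal (μ b) (ν ^ 2 * w b).toNNReal) b).measure_preimage hS.nullMeasurableSet

theorem sqrt_sq_mul {ν : ℝ} (hν : 0 ≤ ν) (x : ℝ) : √(ν ^ 2 * x) = ν * √x := by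
  rw [Real.sqrt_mul (sq_nonneg ν), Real.sqrt_sq hν]

/-- A union bound over the arms and the samples. -/
theorem samplesLaw_outlying_le {g ν : ℝ} (hg : 0 ≤ g) (hν : 0 ≤ ν) (μ : Fin K → ℝ)
    {w : Fin K → ℝ} (hw : ∀ b, 0 ≤ w b) :
    samplesLaw n ν μ w {y | Outlying g ν μ w y} ≤
      ENNReal.ofReal (K * (n * (2 * Real.exp (-(g ^ 2 / 2))))) := by
  have hset : {y : Fin K → Fin n → ℝ | Outlying g ν μ w y} =
      ⋃ b, ⋃ i, Function.eval b ⁻¹' (Function.eval i ⁻¹' {z | g * √(ν ^ 2 * w b) < |z - μ b|}) := by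
    ext y
    simp [Outlying, sqrt_sq_mul hν]
  rw [hset]
  have hone : ∀ (b : Fin K) (i : Fin n), samplesLaw n ν μ w
      (Function.eval b ⁻¹' (Function.eval i ⁻¹' {z | g * √(ν ^ 2 * w b) < |z - μ b|})) ≤
      ENNReal.ofReal (2 * Real.exp (-(g ^ 2 / 2))) := by
    intro b i
    have hm : MeasurableSet {z : ℝ | g * √(ν ^ 2 * w b) < |z - μ b|} :=
      measurableSet_lt (by fun_prop) (by fun_prop)
    rw [samplesLaw_preimage ν μ w b (measurable_pi_apply i hm),
      (measurePreserving_eval (fun _ : Fin n =>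
        gaussianReal (μ b) (ν ^ 2 * w b).toNNReal) i).measure_preimage hm.nullMeasurableSet]
    exact gaussianReal_abs_sub_le _ (mul_nonneg (sq_nonneg ν) (hw b)) hg
  refine (measure_iUnion_le _).trans ?_
  rw [tsum_fintype]
  refine (Finset.sum_le_sum fun b _ => (measure_iUnion_le _).trans_eq (tsum_fintype _)).trans ?_
  refine (Finset.sum_le_sum fun b _ => Finset.sum_le_sum fun i _ => hone b i).trans_eq ?_
  simp only [Finset.sum_const, Finset.card_univ, Fintype.card_fin, nsmul_eq_mul]
  rw [ENNReal.ofReal_mul (p := (K : ℝ)) (by positivity),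
    ENNReal.ofReal_mul (p := (n : ℝ)) (by positivity), ENNReal.ofReal_natCast,
    ENNReal.ofReal_natCast]

/-- All `n` samples of an optimal arm are optimistic with at least the `n`-th power of the
anti-concentration constant as probability, since its true reward is at most `4 / 3` standard
deviations above the mean of the samples. -/
theorem le_samplesLaw_optimistic [NeZero K] {ν : ℝ} (hν : 0 ≤ ν) {ρ μ w : Fin K → ℝ}
    (hw : ∀ b, 0 ≤ w b) (hconf : Confident ν ρ μ w) :
    ENNReal.ofReal ((4 * √Real.pi * Real.exp 1)⁻¹ ^ n) ≤
      samplesLaw n ν μ w {y | Optimistic ρ y} := by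
  obtain ⟨b, hb⟩ := Finite.exists_max ρ
  have hsub : Function.eval b ⁻¹' (Set.univ.pi fun _ : Fin n => Set.Ici (ρ b)) ⊆
      {y : Fin K → Fin n → ℝ | Optimistic ρ y} := fun y hy => ⟨b, hb, fun i => hy i trivial⟩
  refine le_trans ?_ (measure_mono hsub)
  rw [samplesLaw_preimage ν μ w b (MeasurableSet.univ_pi fun _ => measurableSet_Ici),
    Measure.pi_pi, Finset.prod_const, Finset.card_univ, Fintype.card_fin,
    ENNReal.ofReal_pow (by positivity)]
  gcongr
  refine le_gaussianReal_real_Ici _ (mul_nonneg (sq_nonneg ν) (hw b)) ?_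
  rw [sqrt_sq_mul hν]
  linarith [(abs_le.1 (hconf b)).1]

theorem abs_surplus_le [NeZero K] {W g ν β q : ℝ} (hW : 0 ≤ W) (hβ₀ : 0 ≤ β) (hβ₁ : β ≤ 1)
    (hq₀ : 0 < q) (hq₁ : q ≤ 1) (ρ μ : Fin K → ℝ) {w : Fin K → ℝ} (hw : ∀ b, w b ≤ 1)
    (y : Fin K → Fin n → ℝ) : |surplus W g ν β q ρ μ w y| ≤ 1 + 2 * W / q := by
  obtain ⟨hm0, hm1⟩ := minWidth_mem W ρ w hw
  have hA0 : 0 ≤ 2 * W * minWidth W ρ w := by positivity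
  have hA1 : 2 * W * minWidth W ρ w ≤ 2 * W := mul_le_of_le_one_right (by positivity) hm1
  have hA2 : 2 * W * minWidth W ρ w / q ≤ 2 * W / q := by gcongr
  have hA3 : 0 ≤ 2 * W * minWidth W ρ w / q := by positivity
  have hq : 2 * W ≤ 2 * W / q := le_div_self (by positivity) hq₀ hq₁
  unfold surplus
  rw [mul_sub, mul_one, mul_div_assoc']
  rw [abs_le]
  split_ifs <;> constructor <;> simp only [mul_one, mul_zero, zero_div] <;> linarith

theorem integral_surplus_le [NeZero K] {W g ν β q : ℝ} (hW : 0 ≤ W) (hg : 0 ≤ g) (hν : 0 ≤ ν)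
    (hq₀ : 0 < q) {ρ μ w : Fin K → ℝ} (hw₀ : ∀ b, 0 ≤ w b) (hw₁ : ∀ b, w b ≤ 1)
    (hconf : Confident ν ρ μ w) (hβ : K * (n * (2 * Real.exp (-(g ^ 2 / 2)))) ≤ β)
    (hqβ : q + β ≤ (4 * √Real.pi * Real.exp 1)⁻¹ ^ n) :
    ∫ y, surplus W g ν β q ρ μ w y ∂samplesLaw n ν μ w ≤ 0 := by
  set κ := samplesLaw n ν μ w
  have hβ0 : 0 ≤ β := le_trans (by positivity) hβ
  have hBm : MeasurableSet {y : Fin K → Fin n → ℝ | Outlying g ν μ w y} :=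
    measurableSet_outlying g ν measurable_const measurable_const measurable_id
  have hOm : MeasurableSet {y : Fin K → Fin n → ℝ | Optimistic ρ y} :=
    measurableSet_optimistic measurable_const measurable_id
  have h1 : κ.real {y | Outlying g ν μ w y} ≤ β :=
    ENNReal.toReal_le_of_le_ofReal hβ0
      ((samplesLaw_outlying_le hg hν μ hw₀).trans (ENNReal.ofReal_le_ofReal hβ))
  have h2 : q + β ≤ κ.real {y | Optimistic ρ y} := by
    have := (le_samplesLaw_optimistic hν hw₀ hconf (n := n))
    refine hqβ.trans ?_
    rwa [ENNReal.ofReal_le_iff_le_toReal (measure_ne_top _ _)] at this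
  have h3 : q ≤ κ.real ({y | Optimistic ρ y} ∩ {y | Outlying g ν μ w y}ᶜ) := by
    have := measureReal_mono (μ := κ) (s₁ := {y | Optimistic ρ y})
      (s₂ := ({y | Optimistic ρ y} ∩ {y | Outlying g ν μ w y}ᶜ) ∪ {y | Outlying g ν μ w y})
      (fun y hy => by by_cases h : y ∈ {y | Outlying g ν μ w y} <;> simp_all)
    have h4 := measureReal_union_le (μ := κ) ({y | Optimistic ρ y} ∩ {y | Outlying g ν μ w y}ᶜ)
      {y | Outlying g ν μ w y}
    linarith
  have e : ∀ y : Fin K → Fin n → ℝ, surplus W g ν β q ρ μ w y =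
      {y | Outlying g ν μ w y}.indicator 1 y - β + 2 * W * minWidth W ρ w *
        (1 - ({y | Optimistic ρ y} ∩ {y | Outlying g ν μ w y}ᶜ).indicator 1 y / q) := by
    intro y
    classical
    simp [surplus, Set.indicator_apply]
  have hi1 : Integrable ({y | Outlying g ν μ w y}.indicator (1 : (Fin K → Fin n → ℝ) → ℝ)) κ :=
    (integrable_const (1 : ℝ)).indicator hBm
  have hi2 : Integrable (({y | Optimistic ρ y} ∩ {y | Outlying g ν μ w y}ᶜ).indicator
      (1 : (Fin K → Fin n → ℝ) → ℝ)) κ :=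
    (integrable_const (1 : ℝ)).indicator (hOm.inter hBm.compl)
  have hj1 : Integrable (fun y => {y | Outlying g ν μ w y}.indicator
      (1 : (Fin K → Fin n → ℝ) → ℝ) y - β) κ := hi1.sub (integrable_const _)
  have hj2 : Integrable (fun y => 1 - ({y | Optimistic ρ y} ∩ {y | Outlying g ν μ w y}ᶜ).indicator
      (1 : (Fin K → Fin n → ℝ) → ℝ) y / q) κ := (integrable_const _).sub (hi2.div_const _)
  simp only [e]
  rw [integral_add hj1 (hj2.const_mul _), integral_sub hi1 (integrable_const _),
    integral_const_mul, integral_sub (integrable_const _) (hi2.div_const _), integral_div,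
    integral_indicator_one hBm, integral_indicator_one (hOm.inter hBm.compl)]
  simp only [integral_const, probReal_univ, smul_eq_mul, one_mul]
  have hm0 := (minWidth_mem W ρ w hw₁).1
  have h5 : 1 ≤ κ.real ({y | Optimistic ρ y} ∩ {y | Outlying g ν μ w y}ᶜ) / q := by
    rwa [one_le_div hq₀]
  have h6 : 2 * W * minWidth W ρ w *
      (1 - κ.real ({y | Optimistic ρ y} ∩ {y | Outlying g ν μ w y}ᶜ) / q) ≤ 0 :=
    mul_nonpos_of_nonneg_of_nonpos (by positivity) (by linarith)
  linarith

theorem lintegral_exp_surplus_le [NeZero K] {W g ν β q : ℝ} (hW : 0 ≤ W) (hg : 0 ≤ g)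
    (hν : 0 ≤ ν) (hq₀ : 0 < q) (hq₁ : q ≤ 1) (hβ₁ : β ≤ 1) {ρ μ w : Fin K → ℝ}
    (hw₀ : ∀ b, 0 ≤ w b) (hw₁ : ∀ b, w b ≤ 1) (hconf : Confident ν ρ μ w)
    (hβ : K * (n * (2 * Real.exp (-(g ^ 2 / 2)))) ≤ β)
    (hqβ : q + β ≤ (4 * √Real.pi * Real.exp 1)⁻¹ ^ n) {l : ℝ} (hl : 0 ≤ l) :
    ∫⁻ y, ENNReal.ofReal (Real.exp (l * surplus W g ν β q ρ μ w y
      - (1 + 2 * W / q) ^ 2 * l ^ 2 / 2)) ∂samplesLaw n ν μ w ≤ 1 := by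
  set c := 1 + 2 * W / q
  have hβ0 : 0 ≤ β := le_trans (by positivity) hβ
  have hm : Measurable fun y : Fin K → Fin n → ℝ => surplus W g ν β q ρ μ w y :=
    measurable_surplus W g ν β q measurable_const measurable_const measurable_const measurable_id
  have hH := hoeffding_exp_le (κ := samplesLaw n ν μ w) hm.aemeasurable (lo := -c) (hi := c)
    (Filter.Eventually.of_forall fun y =>
      abs_le.1 (abs_surplus_le hW hβ0 hβ₁ hq₀ hq₁ ρ μ hw₁ y)) l
  have hmean := integral_surplus_le hW hg hν hq₀ hw₀ hw₁ hconf hβ hqβ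
  set E := ∫ y, surplus W g ν β q ρ μ w y ∂samplesLaw n ν μ w
  calc _ ≤ ∫⁻ y, ENNReal.ofReal (Real.exp (-(c ^ 2 * l ^ 2 / 2))) *
        ENNReal.ofReal (Real.exp (l * (surplus W g ν β q ρ μ w y - E))) ∂samplesLaw n ν μ w := by
        refine lintegral_mono fun y => ?_
        rw [← ENNReal.ofReal_mul (by positivity), ← Real.exp_add]
        refine ENNReal.ofReal_le_ofReal (Real.exp_le_exp.2 ?_)
        nlinarith
    _ = ENNReal.ofReal (Real.exp (-(c ^ 2 * l ^ 2 / 2))) *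
        ∫⁻ y, ENNReal.ofReal (Real.exp (l * (surplus W g ν β q ρ μ w y - E)))
          ∂samplesLaw n ν μ w := lintegral_const_mul _ (by fun_prop)
    _ ≤ ENNReal.ofReal (Real.exp (-(c ^ 2 * l ^ 2 / 2))) *
        ENNReal.ofReal (Real.exp ((c - -c) ^ 2 * l ^ 2 / 8)) := by gcongr
    _ = 1 := by
        rw [← ENNReal.ofReal_mul (by positivity), ← Real.exp_add]
        ring_nf
        simp

end Round

/-! ### From one round to the whole run -/

section Run

variable {Ω : Type*} {d K n T : ℕ} {δ : ℝ} {θ : Fin K → EuclideanSpace ℝ (Fin d)}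

/-- The true expected rewards of the arms in round `t`. -/
noncomputable def trueRewards (θ : Fin K → EuclideanSpace ℝ (Fin d))
    (s : ℕ → Ω → EuclideanSpace ℝ (Fin d)) (t : ℕ) (ω : Ω) (b : Fin K) : ℝ :=
  expReward θ (s t ω) b

/-- The predicted rewards `s_tᵀ θ̂_b` of the arms in round `t`. -/
noncomputable def predictions (s : ℕ → Ω → EuclideanSpace ℝ (Fin d)) (a : ℕ → Ω → Fin K)
    (R : ℕ → Ω → ℝ) (t : ℕ) (ω : Ω) (b : Fin K) : ℝ :=
  (s t ω).ofLp ⬝ᵥ estimate (fun τ => s τ ω) (fun τ => a τ ω) (fun τ => R τ ω) t b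

/-- The squared widths of the arms in round `t`. -/
noncomputable def postVars (s : ℕ → Ω → EuclideanSpace ℝ (Fin d)) (a : ℕ → Ω → Fin K)
    (t : ℕ) (ω : Ω) (b : Fin K) : ℝ :=
  postVar (fun τ => s τ ω) (fun τ => a τ ω) t b

/-- The surplus of round `t`, with the samples drawn in that round. -/
noncomputable def roundSurplus (W g β q : ℝ) (δ : ℝ) (θ : Fin K → EuclideanSpace ℝ (Fin d))
    (s : ℕ → Ω → EuclideanSpace ℝ (Fin d)) (r : ℕ → Ω → Fin K → Fin n → ℝ)
    (a : ℕ → Ω → Fin K) (R : ℕ → Ω → ℝ) (t : ℕ) (ω : Ω) : ℝ :=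
  surplus W g (samplingScale d δ t) β q (trueRewards θ s t ω) (predictions s a R t ω)
    (postVars s a t ω) (r t ω)

/-- The event that the confidence bounds hold in round `t`. -/
def ConfidentRound (δ : ℝ) (θ : Fin K → EuclideanSpace ℝ (Fin d))
    (s : ℕ → Ω → EuclideanSpace ℝ (Fin d)) (a : ℕ → Ω → Fin K) (R : ℕ → Ω → ℝ)
    (t : ℕ) (ω : Ω) : Prop :=
  Confident (samplingScale d δ t) (trueRewards θ s t ω) (predictions s a R t ω)
    (postVars s a t ω)

theorem samplingScale_nonneg (d : ℕ) (δ : ℝ) (t : ℕ) : 0 ≤ samplingScale d δ t := by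
  unfold samplingScale; positivity

variable [mΩ : MeasurableSpace Ω] {P : Measure Ω} {C : (Fin n → ℝ) → ℝ}
  {Q : Fin K → Kernel (EuclideanSpace ℝ (Fin d)) ℝ} {pre post : Filtration ℕ mΩ}
  {s : ℕ → Ω → EuclideanSpace ℝ (Fin d)} {r : ℕ → Ω → Fin K → Fin n → ℝ}
  {a : ℕ → Ω → Fin K} {R : ℕ → Ω → ℝ}

theorem IsRun.params_meas (h : IsRun P T δ C Q pre post s r a R) {t : ℕ}
    (ht : t ∈ Finset.Icc 1 T) :
    Measurable[pre t] fun ω => (trueRewards θ s t ω, predictions s a R t ω, postVars s a t ω) := by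
  refine Measurable.prodMk ?_ (Measurable.prodMk ?_ ?_)
  · exact (@measurable_pi_iff Ω (Fin K) (fun _ => ℝ) (pre t) _ _).2 fun b => measurable_expReward θ (h.context_meas t ht) b
  · exact (@measurable_pi_iff Ω (Fin K) (fun _ => ℝ) (pre t) _ _).2 fun b => h.prediction_meas ht b
  · exact (@measurable_pi_iff Ω (Fin K) (fun _ => ℝ) (pre t) _ _).2 fun b => h.postVar_meas ht b

open Classical in
/-- The exponential weight of the surplus of round `t + 1`. Rounds before `t₀` and rounds
without confidence bounds carry the weight `1`. -/
noncomputable def surplusFactor (l c W g β q : ℝ) (δ : ℝ) (t₀ : ℕ)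
    (θ : Fin K → EuclideanSpace ℝ (Fin d))
    (s : ℕ → Ω → EuclideanSpace ℝ (Fin d)) (r : ℕ → Ω → Fin K → Fin n → ℝ)
    (a : ℕ → Ω → Fin K) (R : ℕ → Ω → ℝ) (t : ℕ) (ω : Ω) : ℝ :=
  if t₀ ≤ t + 1 ∧ ConfidentRound δ θ s a R (t + 1) ω then
    Real.exp (l * roundSurplus W g β q δ θ s r a R (t + 1) ω - c ^ 2 * l ^ 2 / 2)
  else 1

open Classical in
theorem measurable_exp_surplus (l c W g β q ν : ℝ) (t₀ t : ℕ) :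
    Measurable fun x : ((Fin K → ℝ) × (Fin K → ℝ) × (Fin K → ℝ)) × (Fin K → Fin n → ℝ) =>
      if t₀ ≤ t ∧ Confident ν x.1.1 x.1.2.1 x.1.2.2 then
        Real.exp (l * surplus W g ν β q x.1.1 x.1.2.1 x.1.2.2 x.2 - c ^ 2 * l ^ 2 / 2)
      else 1 := by
  have h1 : MeasurableSet {x : ((Fin K → ℝ) × (Fin K → ℝ) × (Fin K → ℝ)) × (Fin K → Fin n → ℝ) |
      Confident ν x.1.1 x.1.2.1 x.1.2.2} :=
    measurableSet_confident ν (by fun_prop) (by fun_prop) (by fun_prop)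
  have h2 : Measurable
      fun x : ((Fin K → ℝ) × (Fin K → ℝ) × (Fin K → ℝ)) × (Fin K → Fin n → ℝ) =>
      surplus W g ν β q x.1.1 x.1.2.1 x.1.2.2 x.2 :=
    measurable_surplus W g ν β q (by fun_prop) (by fun_prop) (by fun_prop) (by fun_prop)
  exact Measurable.ite ((MeasurableSet.const (t₀ ≤ t)).inter h1)
    ((h2.const_mul l).sub_const _).exp measurable_const

theorem IsRun.surplusFactor_meas (h : IsRun P T δ C Q pre post s r a R) (l c W g β q : ℝ)
    (t₀ : ℕ) {t : ℕ} (ht : t < T) :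
    Measurable[pre (t + 2)] (surplusFactor l c W g β q δ t₀ θ s r a R t) := by
  have htT : t + 1 ∈ Finset.Icc 1 T := Finset.mem_Icc.2 ⟨by omega, ht⟩
  have h1 := (h.params_meas htT (θ := θ)).mono (pre.mono (Nat.le_succ _)) le_rfl
  have h2 := (h.sample_meas _ htT).mono (h.post_le_pre _) le_rfl
  exact (measurable_exp_surplus l c W g β q (samplingScale d δ (t + 1))
    t₀ (t + 1)).comp (h1.prodMk h2)

open Classical in
theorem IsRun.lintegral_surplusFactor_le [NeZero K] [IsProbabilityMeasure P]
    (h : IsRun P T δ C Q pre post s r a R) {W g β q : ℝ} (hW : 0 ≤ W) (hg : 0 ≤ g)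
    (hq₀ : 0 < q) (hq₁ : q ≤ 1) (hβ₁ : β ≤ 1)
    (hβ : K * (n * (2 * Real.exp (-(g ^ 2 / 2)))) ≤ β)
    (hqβ : q + β ≤ (4 * √Real.pi * Real.exp 1)⁻¹ ^ n) {l : ℝ} (hl : 0 ≤ l) (t₀ : ℕ)
    {t : ℕ} (ht : t < T) {G : Ω → ENNReal} (hG : Measurable[pre (t + 1)] G) :
    ∫⁻ ω, G ω * ENNReal.ofReal
      (surplusFactor l (1 + 2 * W / q) W g β q δ t₀ θ s r a R t ω) ∂P ≤ ∫⁻ ω, G ω ∂P := by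
  have htT : t + 1 ∈ Finset.Icc 1 T := Finset.mem_Icc.2 ⟨by omega, ht⟩
  set ν := samplingScale d δ (t + 1) with hν
  have hX : Measurable[pre (t + 1)] fun ω => (G ω, (trueRewards θ s (t + 1) ω,
      predictions s a R (t + 1) ω, postVars s a (t + 1) ω)) := hG.prodMk (h.params_meas htT)
  have haux := measurable_exp_surplus (K := K) (n := n) l (1 + 2 * W / q) W g β q ν
    t₀ (t + 1)
  let f : (ENNReal × ((Fin K → ℝ) × (Fin K → ℝ) × (Fin K → ℝ))) × (Fin K → Fin n → ℝ) →
      ENNReal := fun p => p.1.1 * ENNReal.ofReal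
    (if t₀ ≤ t + 1 ∧ Confident ν p.1.2.1 p.1.2.2.1 p.1.2.2.2 then
        Real.exp (l * surplus W g ν β q p.1.2.1 p.1.2.2.1 p.1.2.2.2 p.2
          - (1 + 2 * W / q) ^ 2 * l ^ 2 / 2)
      else 1)
  have hf : Measurable f := by
    refine Measurable.mul (by fun_prop) (Measurable.ennreal_ofReal ?_)
    exact haux.comp (by fun_prop : Measurable
      fun p : (ENNReal × ((Fin K → ℝ) × (Fin K → ℝ) × (Fin K → ℝ))) × (Fin K → Fin n → ℝ) =>
        (p.1.2, p.2))
  have hlaw : HasCondLaw P (pre (t + 1)) (r (t + 1)) fun ω =>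
      samplesLaw n ν (predictions s a R (t + 1) ω) (postVars s a (t + 1) ω) :=
    h.sample_law _ htT
  have hr : Measurable (r (t + 1)) := (h.sample_meas _ htT).mono (post.le _) le_rfl
  have key := (hlaw.lintegral_eq (pre.le _) hX hr hf).2
  refine key.trans_le (lintegral_mono_ae ?_)
  filter_upwards [h.context_mem _ htT] with ω hω
  simp only [f]
  by_cases hc : t₀ ≤ t + 1 ∧ Confident ν (trueRewards θ s (t + 1) ω)
      (predictions s a R (t + 1) ω) (postVars s a (t + 1) ω)
  · simp only [if_pos hc]
    have hm : Measurable fun y : Fin K → Fin n → ℝ => surplus W g ν β q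
        (trueRewards θ s (t + 1) ω) (predictions s a R (t + 1) ω) (postVars s a (t + 1) ω) y :=
      measurable_surplus W g ν β q measurable_const measurable_const measurable_const
        measurable_id
    rw [lintegral_const_mul _ (by fun_prop)]
    exact mul_le_of_le_one_right' (lintegral_exp_surplus_le hW hg
      (samplingScale_nonneg d δ (t + 1)) hq₀ hq₁ hβ₁
      (fun b => postVar_nonneg (fun τ => s τ ω) (fun τ => a τ ω) (t + 1) b)
      (fun b => postVar_le_one (fun τ => s τ ω) (fun τ => a τ ω) hω.2 b) hc.2 hβ hqβ hl)
  · simp only [if_neg hc]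
    simp

theorem sum_Icc_one_eq_sum_range (f : ℕ → ℝ) (T : ℕ) :
    ∑ t ∈ Finset.Icc 1 T, f t = ∑ t ∈ Finset.range T, f (t + 1) := by
  rw [Finset.range_eq_Ico, Finset.sum_Ico_add' f 0 T 1]
  rfl

/-- An Azuma–Hoeffding bound for the sum of the surpluses. -/
theorem IsRun.measure_sum_surplus_ge_le [NeZero K] [IsProbabilityMeasure P] (hT : 1 ≤ T)
    (h : IsRun P T δ C Q pre post s r a R) {W g β q : ℝ} (hW : 0 ≤ W) (hg : 0 ≤ g)
    (hq₀ : 0 < q) (hq₁ : q ≤ 1) (hβ₁ : β ≤ 1)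
    (hβ : K * (n * (2 * Real.exp (-(g ^ 2 / 2)))) ≤ β)
    (hqβ : q + β ≤ (4 * √Real.pi * Real.exp 1)⁻¹ ^ n) (t₀ : ℕ) {ε : ℝ} (hε₀ : 0 < ε)
    (hε₁ : ε ≤ 1) :
    P {ω | (∀ t ∈ Finset.Icc 1 T, t₀ ≤ t → ConfidentRound δ θ s a R t ω) ∧
      (1 + 2 * W / q) * √(2 * T * Real.log (1 / ε)) ≤
        ∑ t ∈ Finset.Icc 1 T, if t₀ ≤ t then roundSurplus W g β q δ θ s r a R t ω else 0} ≤
      ENNReal.ofReal ε := by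
  set c := 1 + 2 * W / q with hc
  have hc0 : 0 < c := by positivity
  have hT' : (0 : ℝ) < T := by exact_mod_cast hT
  set L := Real.log (1 / ε) with hL
  have hL0 : 0 ≤ L := Real.log_nonneg (by rw [le_div_iff₀ hε₀]; linarith)
  -- the exponent minimizing the exponential bound
  set l := √(2 * L / T) / c with hl
  have hl0 : 0 ≤ l := by positivity
  have hv := measure_exists_le_prod_le P (shift pre) T (ENNReal.ofReal (1 / ε))
    (by simpa using hε₀) ENNReal.ofReal_ne_top
    (fun t ω => ENNReal.ofReal (surplusFactor l c W g β q δ t₀ θ s r a R t ω))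
    (fun t ht => (h.surplusFactor_meas l c W g β q t₀ ht).ennreal_ofReal)
    (fun t ht G hG => h.lintegral_surplusFactor_le hW hg hq₀ hq₁ hβ₁ hβ hqβ hl0 t₀ ht hG)
  rw [← ENNReal.ofReal_inv_of_pos (by positivity), one_div, inv_inv] at hv
  refine (measure_mono ?_).trans hv
  rintro ω ⟨hconf, hsum⟩
  refine ⟨T, le_rfl, ?_⟩
  have hfac : ∀ t ∈ Finset.range T, surplusFactor l c W g β q δ t₀ θ s r a R t ω =
      Real.exp (l * (if t₀ ≤ t + 1 then roundSurplus W g β q δ θ s r a R (t + 1) ω else 0)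
        - if t₀ ≤ t + 1 then c ^ 2 * l ^ 2 / 2 else 0) := by
    intro t ht
    unfold surplusFactor
    by_cases h0 : t₀ ≤ t + 1
    · have := hconf (t + 1) (Finset.mem_Icc.2 ⟨by omega, Finset.mem_range.1 ht⟩) h0
      simp [h0, this]
    · simp [h0]
  rw [← ENNReal.ofReal_prod_of_nonneg fun t ht => by rw [hfac t ht]; positivity]
  refine ENNReal.ofReal_le_ofReal ?_
  rw [Finset.prod_congr rfl hfac, ← Real.exp_sum, Finset.sum_sub_distrib, ← Finset.mul_sum,
    ← sum_Icc_one_eq_sum_range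
      (fun t => if t₀ ≤ t then roundSurplus W g β q δ θ s r a R t ω else 0)]
  have h1 : ∑ t ∈ Finset.range T, (if t₀ ≤ t + 1 then c ^ 2 * l ^ 2 / 2 else 0) ≤
      T * (c ^ 2 * l ^ 2 / 2) := by
    have := Finset.sum_le_card_nsmul (Finset.range T)
      (fun t => if t₀ ≤ t + 1 then c ^ 2 * l ^ 2 / 2 else 0) (c ^ 2 * l ^ 2 / 2)
      (fun t _ => by split_ifs <;> [exact le_rfl; positivity])
    simpa using this
  have h2 : l * (c * √(2 * T * L)) = 2 * L := by
    have : √(2 * L / T) * √(2 * T * L) = 2 * L := by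
      rw [← Real.sqrt_mul (by positivity)]
      have : 2 * L / T * (2 * T * L) = (2 * L) ^ 2 := by field_simp
      rw [this, Real.sqrt_sq (by positivity)]
    rw [← this, hl]
    field_simp
  have h3 : T * (c ^ 2 * l ^ 2 / 2) = L := by
    rw [hl, div_pow, Real.sq_sqrt (by positivity)]
    field_simp
  have h4 := mul_le_mul_of_nonneg_left hsum hl0
  rw [← Real.exp_log (show 0 < ε⁻¹ by positivity), ← one_div, ← hL]
  refine Real.exp_le_exp.2 ?_
  linarith

/-- The pulled arms have a small total posterior deviation. -/
theorem sum_sqrt_postVar_le {s : ℕ → EuclideanSpace ℝ (Fin d)} {a : ℕ → Fin K}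
    (hs : ∀ τ ∈ Finset.Icc 1 T, ‖s τ‖ ≤ 1) :
    ∑ t ∈ Finset.Icc 1 T, √(postVar s a t (a t)) ≤
      √(T * (2 * (K * (d * Real.log (T + 1))))) := by
  refine Real.le_sqrt_of_sq_le ?_
  refine (sq_sum_le_card_mul_sum_sq).trans ?_
  rw [Nat.card_Icc, Nat.add_sub_cancel]
  refine mul_le_mul_of_nonneg_left ?_ (Nat.cast_nonneg T)
  rw [Finset.sum_congr rfl fun t _ => Real.sq_sqrt (postVar_nonneg s a t (a t))]
  exact sum_postVar_le s a hs

/-- The regret bound with probability `1 - δ`, for a sampling half-width `g` in units of the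
standard deviation, a bound `β` on the probability of outlying samples, and a lower bound `q` on the
probability of samples that are optimistic without being outlying. -/
theorem IsRun.measure_regret_gt_le [NeZero K] [IsProbabilityMeasure P] [∀ a, IsMarkovKernel (Q a)]
    (hQ : BoundedLinearRewards θ Q) (hC : IsSandwiched C) (hd : 1 ≤ d) (hT : 1 ≤ T)
    (hδ₀ : 0 < δ) (hδ₁ : δ ≤ 1)
    (h : IsRun P T δ C Q pre post s r a R) {W g β q : ℝ} (hg : 0 ≤ g)
    (hW : ∀ t ∈ Finset.Icc 1 T, (g + 4 / 3) * samplingScale d δ t ≤ W)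
    (hq₀ : 0 < q) (hq₁ : q ≤ 1) (hβ₁ : β ≤ 1)
    (hβ : K * (n * (2 * Real.exp (-(g ^ 2 / 2)))) ≤ β)
    (hqβ : q + β ≤ (4 * √Real.pi * Real.exp 1)⁻¹ ^ n) :
    P {ω | (14 + K) + T * β + (1 + 2 * W / q) * √(2 * T * Real.log (2 / δ)) +
        (W + 2 * W / q) * √(T * (2 * (K * (d * Real.log (T + 1))))) < regret T θ s a ω} ≤
      ENNReal.ofReal δ := by
  have hW0 : 0 ≤ W := le_trans (mul_nonneg (by positivity) (samplingScale_nonneg d δ 1))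
    (hW 1 (Finset.mem_Icc.2 ⟨le_rfl, hT⟩))
  have hβ0 : 0 ≤ β := le_trans (by positivity) hβ
  set t₀ := 14 + K with ht₀
  set E₁ := {ω | ∃ b, ∃ t ≤ T, Real.exp 2 * (K / (δ / 2)) ≤
    errPotential (fun τ => s τ ω) (fun τ => a τ ω) (fun τ => R τ ω) θ (t + 1) b} with hE₁
  set E₂ := {ω | (∀ t ∈ Finset.Icc 1 T, t₀ ≤ t → ConfidentRound δ θ s a R t ω) ∧
      (1 + 2 * W / q) * √(2 * T * Real.log (1 / (δ / 2))) ≤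
        ∑ t ∈ Finset.Icc 1 T, if t₀ ≤ t then roundSurplus W g β q δ θ s r a R t ω else 0} with hE₂
  have h₁ : P E₁ ≤ ENNReal.ofReal (δ / 2) := h.measure_errPotential_ge_le hQ (by positivity)
  have h₂ : P E₂ ≤ ENNReal.ofReal (δ / 2) :=
    h.measure_sum_surplus_ge_le hT hW0 hg hq₀ hq₁ hβ₁ hβ hqβ t₀ (by positivity) (by linarith)
  have hctx : ∀ᵐ ω ∂P, ∀ t ∈ Finset.Icc 1 T, s t ω ∈ contextSpace d :=
    (Finset.eventually_all _).2 h.context_mem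
  have harm : ∀ᵐ ω ∂P, ∀ t ∈ Finset.Icc 1 T, ∀ b, C (r t ω b) ≤ C (r t ω (a t ω)) :=
    (Finset.eventually_all _).2 h.arm_max
  have hsub : {ω | (14 + K) + T * β + (1 + 2 * W / q) * √(2 * T * Real.log (2 / δ)) +
      (W + 2 * W / q) * √(T * (2 * (K * (d * Real.log (T + 1))))) < regret T θ s a ω} ≤ᵐ[P]
      (E₁ ∪ E₂ : Set Ω) := by
    filter_upwards [hctx, harm] with ω hω₁ hω₂ hreg
    by_contra hnot
    obtain ⟨hn₁, hn₂⟩ : ω ∉ E₁ ∧ ω ∉ E₂ := by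
      constructor <;> intro hh <;> exact hnot (by first | exact Or.inl hh | exact Or.inr hh)
    have hconf : ∀ t ∈ Finset.Icc 1 T, t₀ ≤ t → ConfidentRound δ θ s a R t ω := by
      intro t ht htt b
      have hIcc := Finset.mem_Icc.1 ht
      refine abs_prediction_sub_le hd hδ₀ hδ₁ (by omega) (by omega)
        (fun τ hτ => (hω₁ τ (Finset.mem_Icc.2
          ⟨(Finset.mem_Ico.1 hτ).1, (Finset.mem_Ico.1 hτ).2.le.trans hIcc.2⟩)).2) b ?_
      by_contra hlt
      refine hn₁ ⟨b, t - 1, by omega, ?_⟩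
      rw [Nat.sub_add_cancel hIcc.1]
      exact (not_le.1 hlt).le
    have hsum : ∑ t ∈ Finset.Icc 1 T,
        (if t₀ ≤ t then roundSurplus W g β q δ θ s r a R t ω else 0) <
        (1 + 2 * W / q) * √(2 * T * Real.log (2 / δ)) := by
      by_contra hge
      refine hn₂ ⟨hconf, ?_⟩
      rw [one_div_div]
      exact not_lt.1 hge
    have hround : ∀ t ∈ Finset.Icc 1 T,
        (⨆ b, expReward θ (s t ω) b) - expReward θ (s t ω) (a t ω) ≤
        (if t < t₀ then 1 else 0) + β +
        (if t₀ ≤ t then roundSurplus W g β q δ θ s r a R t ω else 0) +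
        (W + 2 * W / q) * √(postVar (fun τ => s τ ω) (fun τ => a τ ω) t (a t ω)) := by
      intro t ht
      have hρ := fun b => hQ.expReward_mem (hω₁ t ht) b
      by_cases htt : t₀ ≤ t
      · have := round_regret_le hC (samplingScale_nonneg d δ t) hg (hW t ht) (β := β) hq₀
          (ρ := trueRewards θ s t ω) hρ
          (fun b => postVar_le_one (fun τ => s τ ω) (fun τ => a τ ω) (hω₁ t ht).2 b)
          (hconf t ht htt) (y := r t ω) (hω₂ t ht)
        rw [if_neg (by omega), if_pos htt, zero_add]
        exact this
      · rw [if_pos (by omega), if_neg htt]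
        have h1 : (⨆ b, expReward θ (s t ω) b) ≤ 1 := ciSup_le fun b => (hρ b).2
        have h2 := (hρ (a t ω)).1
        have h3 : 0 ≤ (W + 2 * W / q) *
          √(postVar (fun τ => s τ ω) (fun τ => a τ ω) t (a t ω)) := by positivity
        linarith
    have hcard : ∑ t ∈ Finset.Icc 1 T, (if t < t₀ then (1 : ℝ) else 0) ≤ 14 + K := by
      rw [Finset.sum_boole]
      have hle : ((Finset.Icc 1 T).filter fun t => t < t₀).card ≤ t₀ := by
        refine (Finset.card_le_card (t := Finset.range t₀) fun t ht => ?_).trans_eq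
          (Finset.card_range _)
        exact Finset.mem_range.2 (Finset.mem_filter.1 ht).2
      calc _ ≤ (t₀ : ℝ) := by exact_mod_cast hle
        _ = _ := by rw [ht₀]; push_cast; ring
    have hfinal := Finset.sum_le_sum hround
    simp only [Finset.sum_add_distrib, ← Finset.mul_sum] at hfinal
    have hwid := sum_sqrt_postVar_le (s := fun τ => s τ ω) (a := fun τ => a τ ω)
      fun τ hτ => (hω₁ τ hτ).2
    have hwid' := mul_le_mul_of_nonneg_left hwid (show 0 ≤ W + 2 * W / q by positivity)
    have hβs : ∑ _t ∈ Finset.Icc 1 T, β = T * β := by simp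
    have hreg' : regret T θ s a ω ≤ _ := hfinal
    have hlt : (14 + K) + T * β + (1 + 2 * W / q) * √(2 * T * Real.log (2 / δ)) +
      (W + 2 * W / q) * √(T * (2 * (K * (d * Real.log (T + 1))))) < regret T θ s a ω := hreg
    linarith
  refine (measure_mono_ae hsub).trans ((measure_union_le _ _).trans ((add_le_add h₁ h₂).trans ?_))
  rw [← ENNReal.ofReal_add (by positivity) (by positivity), add_halves]

end Run

/-! ### Choice of the constants -/

section Constants

theorem le_antiConst : 18 ≤ 4 * √Real.pi * Real.exp 1 := by
  have h1 : 1.7 ≤ √Real.pi := Real.le_sqrt_of_sq_le (by linarith [Real.pi_gt_d2])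
  have h2 := Real.exp_one_gt_d9
  nlinarith

variable {α : ℝ}

theorem le_antiConst_rpow (hα₀ : 0 ≤ α) (hα₁ : α < 1) :
    100 ≤ (4 * √Real.pi * Real.exp 1) ^ ((2 - α) / (1 - α)) := by
  have h := le_antiConst
  have h2 : (2 : ℝ) ≤ (2 - α) / (1 - α) := by
    rw [le_div_iff₀ (by linarith)]; linarith
  refine le_trans ?_ (Real.rpow_le_rpow_of_exponent_le (by linarith) h2)
  rw [Real.rpow_two]
  nlinarith

/-- The exponent `(2 - α) / (1 - α) = 1 + 1 / (1 - α)` is an upper bound of the sample size. -/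
theorem inv_antiConst_rpow_le (hα₁ : α < 1) :
    ((4 * √Real.pi * Real.exp 1) ^ ((2 - α) / (1 - α)))⁻¹ ≤
      (4 * √Real.pi * Real.exp 1)⁻¹ ^ sampleSize α := by
  have h := le_antiConst
  have h1α : 0 < 1 - α := by linarith
  rw [inv_pow]
  refine inv_anti₀ (by positivity) ?_
  rw [← Real.rpow_natCast]
  refine Real.rpow_le_rpow_of_exponent_le (by linarith) ?_
  have h1 : (sampleSize α : ℝ) < 1 / (1 - α) + 1 := Nat.ceil_lt_add_one (by positivity)
  refine h1.le.trans_eq ?_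
  field_simp
  ring

theorem sampleSize_mul_le (hα₀ : 0 ≤ α) (hα₁ : α < 1) : (sampleSize α : ℝ) * (1 - α) ≤ 2 := by
  have h1α : 0 < 1 - α := by linarith
  have h1 : (sampleSize α : ℝ) < 1 / (1 - α) + 1 := Nat.ceil_lt_add_one (by positivity)
  have h2 : (sampleSize α : ℝ) * (1 - α) ≤ (1 / (1 - α) + 1) * (1 - α) := by gcongr
  have h3 : (1 / (1 - α) + 1) * (1 - α) = 1 + (1 - α) := by field_simp
  linarith

/-- If the regret bound is smaller than the trivial bound `T`, then the number of rounds is large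
compared with all the other parameters. -/
theorem large_of_bound_lt {Λ M D d K T : ℝ} (hΛ : 100 ≤ Λ) (hM : 1 / 2 ≤ M) (hT : 1 ≤ T)
    (hd : 1 ≤ d) (hK : 0 ≤ K) (hD : √T ≤ D)
    (h : 3 * Λ / 2 * M * (15 * √(d * K * T * Real.log T) + 6 * D) < T) :
    1000 ≤ T ∧ 100 * Λ ≤ T ∧ K ≤ T := by
  set A := √(d * K * T * Real.log T) with hA
  have hA0 : 0 ≤ A := Real.sqrt_nonneg _
  have hsT : 0 < √T := Real.sqrt_pos.2 (by linarith)
  have hsq : √T * √T = T := Real.mul_self_sqrt (by linarith)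
  have hΛM : 50 ≤ Λ * M := by nlinarith
  have hΛM' : Λ / 2 ≤ Λ * M := by nlinarith
  have hexp : 3 * Λ / 2 * M * (15 * A + 6 * D) = 45 / 2 * (Λ * M) * A + 9 * (Λ * M) * D := by ring
  rw [hexp] at h
  have h1 : 9 * (Λ * M) * √T ≤ 9 * (Λ * M) * D := by gcongr
  have h2 : 0 ≤ 45 / 2 * (Λ * M) * A := by positivity
  have h3 : 9 * (Λ * M) * √T < √T * √T := by linarith
  have h4 : 9 * (Λ * M) < √T := lt_of_mul_lt_mul_right h3 hsT.le
  have h5 : 4 * Λ ≤ √T := by linarith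
  have hTΛ : 100 * Λ ≤ T := by rw [← hsq]; nlinarith
  refine ⟨by linarith, hTΛ, ?_⟩
  have hlog : 1 ≤ Real.log T := by
    rw [Real.le_log_iff_exp_le (by linarith)]
    linarith [Real.exp_one_lt_d9]
  have h6 : 0 ≤ 9 * (Λ * M) * D := le_trans (by positivity) h1
  have h7 : A ≤ T := by nlinarith
  have h8 : K * T ≤ A ^ 2 := by
    rw [hA, Real.sq_sqrt (by positivity)]
    have : 1 * 1 ≤ d * Real.log T := by gcongr
    have h9 : 0 ≤ K * T := by positivity
    nlinarith
  have h10 : K * T ≤ T * T := h8.trans (by nlinarith)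
  exact le_of_mul_le_mul_right h10 (by linarith)

/-- The terms of `IsRun.measure_regret_gt_le` for `W = √2 M`, `β = 2 K / T²` and
`q = 9 / (10 Λ)` add up to at most half of the claimed bound. -/
theorem regret_terms_le {Λ M A D X T K : ℝ} (hΛ : 100 ≤ Λ) (hM : 1 ≤ M) (hK : 0 ≤ K)
    (hT : 2 ≤ T) (hKA : K ≤ A) (hA : 1 ≤ A) (hD : 0 ≤ D) (hX : X ≤ 2 * A) :
    (14 + K) + T * (2 * K / T ^ 2) + (1 + 2 * (√2 * M) / (9 / (10 * Λ))) * D +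
      (√2 * M + 2 * (√2 * M) / (9 / (10 * Λ))) * X ≤
      3 * Λ / 2 * M * (15 * A + 6 * D) / 2 := by
  have hs2 : √(2 : ℝ) ≤ 1.415 := by
    rw [Real.sqrt_le_left (by norm_num)]; norm_num
  have hs0 : 0 ≤ √(2 : ℝ) := Real.sqrt_nonneg 2
  set N := Λ * M with hN
  have hN100 : 100 ≤ N := by nlinarith
  have hΛ0 : 0 < Λ := by linarith
  have e1 : 2 * (√2 * M) / (9 / (10 * Λ)) = 20 / 9 * √2 * N := by rw [hN]; field_simp; norm_num
  have e2 : T * (2 * K / T ^ 2) = 2 * K / T := by field_simp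
  have h1 : 2 * K / T ≤ K := by
    rw [div_le_iff₀ (by linarith)]; nlinarith
  have h2 : 20 / 9 * √2 * N ≤ 3.15 * N := by
    have : 20 / 9 * √2 ≤ 3.15 := by linarith
    gcongr
  have h3 : √2 * M ≤ 0.02 * N := by
    have : √2 * M ≤ 1.415 * M := by gcongr
    have : 100 * M ≤ N := by rw [hN]; gcongr
    linarith
  rw [e1, e2]
  have h4 : (1 + 20 / 9 * √2 * N) * D ≤ (3.2 * N) * D := by gcongr; linarith
  have h5 : (√2 * M + 20 / 9 * √2 * N) * X ≤ (3.2 * N) * (2 * A) := by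
    have h6 : 0 ≤ √2 * M + 20 / 9 * √2 * N := by positivity
    calc _ ≤ (√2 * M + 20 / 9 * √2 * N) * (2 * A) := by gcongr
      _ ≤ _ := by gcongr; linarith
  have h6 : 16 * A ≤ N * A := by gcongr; linarith
  have h7 : 3 * Λ / 2 * M * (15 * A + 6 * D) / 2 = 11.25 * (N * A) + 4.5 * (N * D) := by
    rw [hN]; ring
  have h8 : 0 ≤ N * D := by positivity
  have h9 : 0 ≤ N * A := by positivity
  rw [h7]
  linarith

end Constants

/-! ### The regret bounds -/

section Run

variable {Ω : Type*} [mΩ : MeasurableSpace Ω] {P : Measure Ω}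
  {d K T : ℕ} {α δ : ℝ} {θ : Fin K → EuclideanSpace ℝ (Fin d)}
  {Q : Fin K → Kernel (EuclideanSpace ℝ (Fin d)) ℝ}
  {C : (Fin (sampleSize α) → ℝ) → ℝ} {pre post : Filtration ℕ mΩ}
  {s : ℕ → Ω → EuclideanSpace ℝ (Fin d)} {r : ℕ → Ω → Fin K → Fin (sampleSize α) → ℝ}
  {a : ℕ → Ω → Fin K} {R : ℕ → Ω → ℝ}

theorem IsRun.measurable_regret (h : IsRun P T δ C Q pre post s r a R) :
    Measurable (regret T θ s a) := by
  unfold regret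
  refine Finset.measurable_sum _ fun t ht => ?_
  have hs : Measurable (s t) := (h.context_meas t ht).mono (pre.le t) le_rfl
  have ha : Measurable (a t) := (h.arm_meas t ht).mono (post.le t) le_rfl
  refine (Measurable.iSup fun b => measurable_expReward θ hs b).sub ?_
  have e : (fun ω => expReward θ (s t ω) (a t ω)) =
      fun ω => ∑ b, if a t ω = b then expReward θ (s t ω) b else 0 := by
    ext ω; simp
  rw [e]
  exact Finset.measurable_sum _ fun b _ => Measurable.ite (ha (measurableSet_singleton b))
    (measurable_expReward θ hs b) measurable_const

variable [∀ a, IsMarkovKernel (Q a)]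

theorem IsRun.regret_mem [NeZero K] (hQ : BoundedLinearRewards θ Q)
    (h : IsRun P T δ C Q pre post s r a R) :
    ∀ᵐ ω ∂P, regret T θ s a ω ∈ Set.Icc (0 : ℝ) T := by
  have hctx : ∀ᵐ ω ∂P, ∀ t ∈ Finset.Icc 1 T, s t ω ∈ contextSpace d :=
    (Finset.eventually_all _).2 h.context_mem
  filter_upwards [hctx] with ω hω
  constructor
  · exact Finset.sum_nonneg fun t _ => sub_nonneg.2
      (le_ciSup (f := fun b => expReward θ (s t ω) b) (Set.finite_range _).bddAbove (a t ω))
  · refine (Finset.sum_le_card_nsmul _ _ 1 fun t ht => ?_).trans_eq (by simp)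
    have h1 : (⨆ b, expReward θ (s t ω) b) ≤ 1 :=
      ciSup_le fun b => (hQ.expReward_mem (hω t ht) b).2
    linarith [(hQ.expReward_mem (hω t ht) (a t ω)).1]

variable [IsProbabilityMeasure P]

/-- When the number of rounds is large compared with the other parameters, half of the claimed
bound suffices. -/
theorem IsRun.measure_half_bound_lt_le [NeZero K] (hQ : BoundedLinearRewards θ Q)
    (hC : IsSandwiched C) (hα₀ : 0 ≤ α) (hα₁ : α < 1) (hd : 1 ≤ d)
    (hδ₀ : 0 < δ) (hδ₁ : δ ≤ 1) (h : IsRun P T δ C Q pre post s r a R) (hT : 1000 ≤ T)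
    (hΛT : 100 * (4 * √Real.pi * Real.exp 1) ^ ((2 - α) / (1 - α)) ≤ T) (hKT : K ≤ T) :
    P {ω | 3 * (4 * √Real.pi * Real.exp 1) ^ ((2 - α) / (1 - α)) / 2
          * √(d * Real.log (4 * T / δ) * Real.log (2 * (T : ℝ) ^ 2 / (1 - α)))
          * (15 * √(d * K * T * Real.log T) + 6 * √(2 * T * Real.log (2 / δ))) / 2 <
        regret T θ s a ω} ≤ ENNReal.ofReal δ := by
  have hT' : (1000 : ℝ) ≤ T := by exact_mod_cast hT
  have hKT' : (K : ℝ) ≤ T := by exact_mod_cast hKT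
  have hd' : (1 : ℝ) ≤ d := by exact_mod_cast hd
  have hK : (1 : ℝ) ≤ K := by exact_mod_cast Nat.one_le_iff_ne_zero.2 (NeZero.ne K)
  have h1α : 0 < 1 - α := by linarith
  have hΛ := le_antiConst_rpow hα₀ hα₁
  set Λ := (4 * √Real.pi * Real.exp 1) ^ ((2 - α) / (1 - α)) with hΛdef
  set ℓ := Real.log (2 * (T : ℝ) ^ 2 / (1 - α)) with hℓ
  set Lδ := Real.log (4 * T / δ) with hLδ
  set M := √(d * Lδ * ℓ) with hM
  -- with `g² = 2 ℓ`, outlying samples have probability at most `K n (1 - α) / T² ≤ β`, a small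
  -- fraction of the probability `1 / Λ` of optimistic ones
  set β := 2 * (K : ℝ) / (T : ℝ) ^ 2 with hβ
  set q := 9 / (10 * Λ) with hq
  have hΛ0 : 0 < Λ := by linarith
  have hℓ8 : 8 ≤ ℓ := by
    rw [hℓ, Real.le_log_iff_exp_le (by positivity), le_div_iff₀ h1α]
    have he : Real.exp 8 ≤ 2 * (T : ℝ) ^ 2 := by
      have h := Real.exp_one_lt_d9
      have : Real.exp 8 = Real.exp 1 ^ 8 := by rw [← Real.exp_nat_mul]; norm_num
      rw [this]
      calc Real.exp 1 ^ 8 ≤ 3 ^ 8 := by gcongr; linarith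
        _ ≤ 2 * 1000 ^ 2 := by norm_num
        _ ≤ _ := by gcongr
    nlinarith [Real.exp_pos 8]
  have hL1 : 1 ≤ Lδ := by
    rw [hLδ, Real.le_log_iff_exp_le (by positivity), le_div_iff₀ hδ₀]
    nlinarith [Real.exp_one_lt_d9, Real.exp_pos 1]
  have hlogT : 1 ≤ Real.log T := by
    rw [Real.le_log_iff_exp_le (by linarith)]
    linarith [Real.exp_one_lt_d9]
  have hM1 : 1 ≤ M := by
    refine Real.le_sqrt_of_sq_le ?_
    have : 1 * 1 * 1 ≤ d * Lδ * ℓ := by gcongr; linarith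
    linarith
  have hqβ : q + β ≤ (4 * √Real.pi * Real.exp 1)⁻¹ ^ sampleSize α := by
    refine le_trans ?_ (inv_antiConst_rpow_le hα₁)
    have h1 : β ≤ 1 / (10 * Λ) := by
      rw [hβ, div_le_div_iff₀ (by positivity) (by positivity)]
      have : (K : ℝ) * Λ ≤ T * (T / 100) := by gcongr; linarith
      nlinarith
    have h2 : 9 / (10 * Λ) + 1 / (10 * Λ) = Λ⁻¹ := by field_simp; norm_num
    linarith
  have hq1 : q ≤ 1 := by
    rw [hq, div_le_one (by positivity)]; linarith
  have hβ1 : β ≤ 1 := by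
    rw [hβ, div_le_one (by positivity)]; nlinarith
  have hg2 : √(2 * ℓ) ^ 2 = 2 * ℓ := Real.sq_sqrt (by positivity)
  have hβ2 : K * (sampleSize α * (2 * Real.exp (-(√(2 * ℓ) ^ 2 / 2)))) ≤ β := by
    have e : Real.exp (-(√(2 * ℓ) ^ 2 / 2)) = (1 - α) / (2 * (T : ℝ) ^ 2) := by
      rw [hg2, mul_div_cancel_left₀ _ two_ne_zero, Real.exp_neg, hℓ,
        Real.exp_log (by positivity), inv_div]
    rw [e, hβ]
    have h2 := sampleSize_mul_le hα₀ hα₁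
    calc K * (sampleSize α * (2 * ((1 - α) / (2 * (T : ℝ) ^ 2))))
        = K * (sampleSize α * (1 - α)) / (T : ℝ) ^ 2 := by field_simp
      _ ≤ K * 2 / (T : ℝ) ^ 2 := by gcongr
      _ = _ := by ring
  have hW : ∀ t ∈ Finset.Icc 1 T, (√(2 * ℓ) + 4 / 3) * samplingScale d δ t ≤ √2 * M := by
    intro t ht
    have ht1 : (1 : ℝ) ≤ t := by exact_mod_cast (Finset.mem_Icc.1 ht).1
    have ht2 : (t : ℝ) ≤ T := by exact_mod_cast (Finset.mem_Icc.1 ht).2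
    have h1 : samplingScale d δ t ≤ 3 / 4 * √(d * Lδ) := by
      unfold samplingScale
      rw [hLδ]
      gcongr
    have h2 : 4 ≤ √(2 * ℓ) := Real.le_sqrt_of_sq_le (by linarith)
    have h3 : √2 * M = √(2 * ℓ) * √(d * Lδ) := by
      rw [hM, ← Real.sqrt_mul (by norm_num), ← Real.sqrt_mul (by positivity)]
      ring_nf
    rw [h3]
    have h4 : (√(2 * ℓ) + 4 / 3) * samplingScale d δ t ≤
        (√(2 * ℓ) + 4 / 3) * (3 / 4 * √(d * Lδ)) := by gcongr
    nlinarith [Real.sqrt_nonneg (d * Lδ)]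
  have hmain := h.measure_regret_gt_le hQ hC hd (by omega) hδ₀ hδ₁ (Real.sqrt_nonneg (2 * ℓ)) hW
    (by positivity) hq1 hβ1 hβ2 hqβ
  refine (measure_mono ?_).trans hmain
  intro ω hω
  rw [Set.mem_ofPred_eq] at hω ⊢
  refine lt_of_le_of_lt ?_ hω
  refine regret_terms_le hΛ hM1 (by positivity) (by linarith) ?_ ?_ (Real.sqrt_nonneg _) ?_
  · refine Real.le_sqrt_of_sq_le ?_
    have h1 : 1 * (K : ℝ) * K * 1 ≤ d * K * T * Real.log T := by gcongr
    nlinarith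
  · refine Real.le_sqrt_of_sq_le ?_
    have h1 : (1 : ℝ) * 1 * 1 * 1 ≤ d * K * T * Real.log T := by gcongr; linarith
    linarith
  · have hlog : Real.log (T + 1) ≤ 2 * Real.log T := by
      have : 2 * Real.log T = Real.log ((T : ℝ) ^ 2) := by rw [Real.log_pow]; norm_num
      rw [this]
      refine Real.log_le_log (by linarith) (by nlinarith)
    rw [Real.sqrt_le_left (by positivity), mul_pow, Real.sq_sqrt (by positivity)]
    have : (T : ℝ) * (2 * (K * (d * Real.log (T + 1)))) ≤
        T * (2 * (K * (d * (2 * Real.log T)))) := by gcongr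
    linarith

end Run

theorem regret_eq_zero_of_dim_zero {Ω : Type*} {K T : ℕ} (θ : Fin K → EuclideanSpace ℝ (Fin 0))
    (s : ℕ → Ω → EuclideanSpace ℝ (Fin 0)) (a : ℕ → Ω → Fin K) (ω : Ω) :
    regret T θ s a ω = 0 := by
  simp [regret, expReward]

theorem half_le_sqrt_mul {x y z : ℝ} (hx : 1 ≤ x) (hy : 1 / 2 ≤ y) (hz : 1 / 2 ≤ z) :
    1 / 2 ≤ √(x * y * z) := by
  refine Real.le_sqrt_of_sq_le ?_
  have : 1 * (1 / 2) * (1 / 2) ≤ x * y * z := by gcongr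
  linarith

theorem half_le_log {x : ℝ} (hx : 2 ≤ x) : 1 / 2 ≤ Real.log x :=
  le_trans (by linarith [Real.log_two_gt_d9]) (Real.log_le_log (by norm_num) hx)

section RegretBounds

variable {Ω : Type*} [mΩ : MeasurableSpace Ω] {P : Measure Ω} [IsProbabilityMeasure P]
  {d K T : ℕ} {α δ : ℝ} {θ : Fin K → EuclideanSpace ℝ (Fin d)}
  {Q : Fin K → Kernel (EuclideanSpace ℝ (Fin d)) ℝ} [∀ a, IsMarkovKernel (Q a)]
  {C : (Fin (sampleSize α) → ℝ) → ℝ} {pre post : Filtration ℕ mΩ}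
  {s : ℕ → Ω → EuclideanSpace ℝ (Fin d)} {r : ℕ → Ω → Fin K → Fin (sampleSize α) → ℝ}
  {a : ℕ → Ω → Fin K} {R : ℕ → Ω → ℝ}

theorem IsRun.le_prob_regret_le [NeZero K] (hQ : BoundedLinearRewards θ Q)
    (hC : IsSandwiched C) (hT : 1 ≤ T) (hα₀ : 0 ≤ α) (hα₁ : α < 1)
    (hδ₀ : 0 < δ) (hδ₁ : δ ≤ 1) (h : IsRun P T δ C Q pre post s r a R) :
    1 - δ ≤ P.real {ω | regret T θ s a ω ≤
      3 * (4 * √Real.pi * Real.exp 1) ^ ((2 - α) / (1 - α)) / 2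
        * √(d * Real.log (4 * T / δ) * Real.log (2 * (T : ℝ) ^ 2 / (1 - α)))
        * (15 * √(d * K * T * Real.log T) + 6 * √(2 * T * Real.log (2 / δ)))} := by
  set B := 3 * (4 * √Real.pi * Real.exp 1) ^ ((2 - α) / (1 - α)) / 2
        * √(d * Real.log (4 * T / δ) * Real.log (2 * (T : ℝ) ^ 2 / (1 - α)))
        * (15 * √(d * K * T * Real.log T) + 6 * √(2 * T * Real.log (2 / δ))) with hB
  have hB0 : 0 ≤ B := by positivity
  have h1α : 0 < 1 - α := by linarith
  have hT' : (1 : ℝ) ≤ T := by exact_mod_cast hT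
  suffices hbad : P {ω | B < regret T θ s a ω} ≤ ENNReal.ofReal δ by
    have h1 : P.real {ω | B < regret T θ s a ω} ≤ δ := ENNReal.toReal_le_of_le_ofReal hδ₀.le hbad
    have h2 : {ω | B < regret T θ s a ω}ᶜ = {ω | regret T θ s a ω ≤ B} := by
      ext ω; simp
    rw [← h2, probReal_compl_eq_one_sub (measurableSet_lt measurable_const h.measurable_regret)]
    linarith
  rcases Nat.eq_zero_or_pos d with rfl | hd
  · have : {ω | B < regret T θ s a ω} = ∅ := by
      ext ω
      simpa [regret_eq_zero_of_dim_zero] using hB0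
    rw [this]; simp
  have hd' : (1 : ℝ) ≤ d := by exact_mod_cast hd
  -- a bound of at least `T` is trivial, since a round costs at most `1`
  rcases le_or_gt (T : ℝ) B with hTB | hBT
  · have : P {ω | B < regret T θ s a ω} = 0 := by
      have := h.regret_mem hQ
      refine measure_mono_null (fun ω (hω : B < regret T θ s a ω) => ?_) (ae_iff.1 this)
      exact fun hmem => absurd hmem.2 (not_le.2 (hTB.trans_lt hω))
    rw [this]; exact zero_le
  · have hΛ := le_antiConst_rpow hα₀ hα₁
    obtain ⟨h1, h2, h3⟩ := large_of_bound_lt hΛ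
      (half_le_sqrt_mul hd' (half_le_log (by rw [le_div_iff₀ hδ₀]; nlinarith))
        (half_le_log (by rw [le_div_iff₀ h1α]; nlinarith))) hT' hd' (Nat.cast_nonneg K)
      (Real.sqrt_le_sqrt (by
        have : 1 / 2 ≤ Real.log (2 / δ) := half_le_log (by rw [le_div_iff₀ hδ₀]; linarith)
        nlinarith)) hBT
    refine (measure_mono fun ω hω => ?_).trans (h.measure_half_bound_lt_le hQ hC hα₀ hα₁ hd hδ₀ hδ₁
      (by exact_mod_cast h1) h2 (by exact_mod_cast h3))
    rw [Set.mem_ofPred_eq] at hω ⊢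
    rw [← hB]
    linarith

/-- Integrating the bound of probability `1 - 1 / T²` costs a factor `√(3 / 2)`, from `log (4 T³)`
against `log (4 T²)`, and an additive `1 / T`; half of the bound leaves room for both. -/
theorem IsRun.integral_regret_le [NeZero K] (hQ : BoundedLinearRewards θ Q)
    (hC : IsSandwiched C) (hT : 1 ≤ T) (hα₀ : 0 ≤ α) (hα₁ : α < 1)
    (h : IsRun P T (1 / (T : ℝ) ^ 2) C Q pre post s r a R) :
    Integrable (regret T θ s a) P ∧
      ∫ ω, regret T θ s a ω ∂P ≤
        3 * (4 * √Real.pi * Real.exp 1) ^ ((2 - α) / (1 - α)) / 2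
          * √(d * Real.log (4 * (T : ℝ) ^ 2) * Real.log (2 * (T : ℝ) ^ 2 / (1 - α)))
          * (15 * √(d * K * T * Real.log T) + 6 * √(2 * T * Real.log (2 * (T : ℝ) ^ 2))) := by
  have hmem := h.regret_mem hQ
  have hint : Integrable (regret T θ s a) P :=
    Integrable.of_mem_Icc 0 T h.measurable_regret.aemeasurable hmem
  refine ⟨hint, ?_⟩
  have hΛ := le_antiConst_rpow hα₀ hα₁
  set Λ := (4 * √Real.pi * Real.exp 1) ^ ((2 - α) / (1 - α)) with hΛdef
  set M := √(d * Real.log (4 * (T : ℝ) ^ 2) * Real.log (2 * (T : ℝ) ^ 2 / (1 - α))) with hM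
  set D := √(2 * T * Real.log (2 * (T : ℝ) ^ 2)) with hD
  set A := √(d * K * T * Real.log T) with hA
  have h1α : 0 < 1 - α := by linarith
  have hT' : (1 : ℝ) ≤ T := by exact_mod_cast hT
  rcases Nat.eq_zero_or_pos d with rfl | hd
  · simp only [regret_eq_zero_of_dim_zero, integral_zero]
    positivity
  have hd' : (1 : ℝ) ≤ d := by exact_mod_cast hd
  rcases le_or_gt (T : ℝ) (3 * Λ / 2 * M * (15 * A + 6 * D)) with hTB | hBT
  · refine le_trans ?_ hTB
    have := integral_mono_ae hint (integrable_const (T : ℝ)) (hmem.mono fun ω hω => hω.2)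
    simpa using this
  have hM2 : 1 / 2 ≤ M := half_le_sqrt_mul hd' (half_le_log (by nlinarith))
    (half_le_log (by rw [le_div_iff₀ h1α]; nlinarith))
  have hDT : √T ≤ D := by
    have : 1 / 2 ≤ Real.log (2 * (T : ℝ) ^ 2) := half_le_log (by nlinarith)
    exact Real.sqrt_le_sqrt (by nlinarith)
  obtain ⟨h1, h2, h3⟩ := large_of_bound_lt hΛ hM2 hT' hd' (Nat.cast_nonneg K) hDT hBT
  have hhalf := h.measure_half_bound_lt_le hQ hC hα₀ hα₁ hd (by positivity)
    (by rw [div_le_one (by positivity)]; nlinarith) (by exact_mod_cast h1) h2 (by exact_mod_cast h3)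
  have e1 : 2 / (1 / (T : ℝ) ^ 2) = 2 * (T : ℝ) ^ 2 := by field_simp
  have e2 : 4 * (T : ℝ) / (1 / (T : ℝ) ^ 2) = 4 * (T : ℝ) ^ 3 := by field_simp
  rw [e1, e2, ← hΛdef, ← hA, ← hD] at hhalf
  have hM3 : √(d * Real.log (4 * (T : ℝ) ^ 3) * Real.log (2 * (T : ℝ) ^ 2 / (1 - α))) ≤
      5 / 4 * M := by
    have hl4 : 0 ≤ Real.log 4 := Real.log_nonneg (by norm_num)
    have hl : Real.log (4 * (T : ℝ) ^ 3) ≤ 3 / 2 * Real.log (4 * (T : ℝ) ^ 2) := by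
      rw [Real.log_mul (by norm_num) (by positivity), Real.log_mul (by norm_num) (by positivity),
        Real.log_pow, Real.log_pow]
      push_cast
      linarith
    have hl2 : 0 ≤ Real.log (4 * (T : ℝ) ^ 2) :=
      le_trans (by norm_num) (half_le_log (x := 4 * (T : ℝ) ^ 2) (by nlinarith))
    have hl3 : 0 ≤ Real.log (2 * (T : ℝ) ^ 2 / (1 - α)) :=
      le_trans (by norm_num) (half_le_log (x := 2 * (T : ℝ) ^ 2 / (1 - α))
        (by rw [le_div_iff₀ h1α]; nlinarith))
    rw [Real.sqrt_le_left (by positivity), mul_pow, hM, Real.sq_sqrt (by positivity)]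
    have h4 : d * Real.log (4 * (T : ℝ) ^ 3) * Real.log (2 * (T : ℝ) ^ 2 / (1 - α)) ≤
        d * (3 / 2 * Real.log (4 * (T : ℝ) ^ 2)) * Real.log (2 * (T : ℝ) ^ 2 / (1 - α)) := by
      gcongr
    have h5 : 0 ≤ d * Real.log (4 * (T : ℝ) ^ 2) * Real.log (2 * (T : ℝ) ^ 2 / (1 - α)) := by
      positivity
    linarith
  set S := 3 * Λ / 2 * √(d * Real.log (4 * (T : ℝ) ^ 3) * Real.log (2 * (T : ℝ) ^ 2 / (1 - α))) *
    (15 * A + 6 * D) / 2 with hS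
  have hA0 : 0 ≤ A := Real.sqrt_nonneg _
  have hD0 : 0 ≤ D := Real.sqrt_nonneg _
  have hS1 : S ≤ 5 / 8 * (3 * Λ / 2 * M * (15 * A + 6 * D)) := by
    calc S ≤ 3 * Λ / 2 * (5 / 4 * M) * (15 * A + 6 * D) / 2 := by rw [hS]; gcongr
      _ = _ := by ring
  have hB1 : 8 ≤ 3 * Λ / 2 * M * (15 * A + 6 * D) := by
    have hD1 : 1 ≤ D := le_trans (Real.one_le_sqrt.2 hT') hDT
    calc (8 : ℝ) ≤ 3 * 100 / 2 * (1 / 2) * (15 * 0 + 6 * 1) := by norm_num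
      _ ≤ _ := by gcongr
  have hEm : MeasurableSet {ω | S < regret T θ s a ω} :=
    measurableSet_lt measurable_const h.measurable_regret
  have hE : P.real {ω | S < regret T θ s a ω} ≤ 1 / (T : ℝ) ^ 2 :=
    ENNReal.toReal_le_of_le_ofReal (by positivity) hhalf
  have hS0 : 0 ≤ S := by positivity
  have hle : ∀ᵐ ω ∂P, regret T θ s a ω ≤
      S + {ω | S < regret T θ s a ω}.indicator (fun _ => (T : ℝ)) ω := by
    filter_upwards [hmem] with ω hω
    by_cases hω' : S < regret T θ s a ω
    · rw [Set.indicator_of_mem (by exact hω')]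
      linarith [hω.2]
    · rw [Set.indicator_of_notMem (by exact hω')]
      linarith
  have hintE : Integrable ({ω | S < regret T θ s a ω}.indicator fun _ => (T : ℝ)) P :=
    (integrable_const _).indicator hEm
  have hfin := integral_mono_ae hint ((integrable_const S).add hintE) hle
  simp only [Pi.add_apply] at hfin
  rw [integral_add (integrable_const S) hintE, integral_indicator_const _ hEm] at hfin
  simp only [integral_const, probReal_univ, smul_eq_mul, one_mul] at hfin
  have hlast : P.real {ω | S < regret T θ s a ω} * (T : ℝ) ≤ 1 := by
    calc P.real {ω | S < regret T θ s a ω} * (T : ℝ) ≤ 1 / (T : ℝ) ^ 2 * T := by gcongr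
      _ = 1 / T := by field_simp
      _ ≤ 1 := by rw [div_le_one (by linarith)]; exact hT'
  linarith

end RegretBounds

end BRCMAB

theorem theorem3 {Ω : Type*} [mΩ : MeasurableSpace Ω] (P : Measure Ω) [IsProbabilityMeasure P]
    {d K T : ℕ} (hT : 1 ≤ T) (α : ℝ) (hα₀ : 0 ≤ α) (hα₁ : α < 1)
    (θ : Fin K → EuclideanSpace ℝ (Fin d))
    (Q : Fin K → Kernel (EuclideanSpace ℝ (Fin d)) ℝ) [∀ a, IsMarkovKernel (Q a)]
    (hQ : BRCMAB.BoundedLinearRewards θ Q)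
    (C : (Fin (BRCMAB.sampleSize α) → ℝ) → ℝ)
    (hC : C = BRCMAB.modCVaR α ∨ C = BRCMAB.mcCVaR α)
    (pre post : Filtration ℕ mΩ)
    (s : ℕ → Ω → EuclideanSpace ℝ (Fin d))
    (r : ℕ → Ω → Fin K → Fin (BRCMAB.sampleSize α) → ℝ)
    (a : ℕ → Ω → Fin K) (R : ℕ → Ω → ℝ) :
    (∀ δ : ℝ, 0 < δ → δ < 1 → BRCMAB.IsRun P T δ C Q pre post s r a R →
      1 - δ ≤ P.real {ω | BRCMAB.regret T θ s a ω ≤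
        3 * (4 * √Real.pi * Real.exp 1) ^ ((2 - α) / (1 - α)) / 2
          * √(d * Real.log (4 * T / δ) * Real.log (2 * (T : ℝ) ^ 2 / (1 - α)))
          * (15 * √(d * K * T * Real.log T) + 6 * √(2 * T * Real.log (2 / δ)))}) ∧
    (BRCMAB.IsRun P T (1 / (T : ℝ) ^ 2) C Q pre post s r a R →
      Integrable (BRCMAB.regret T θ s a) P ∧
      ∫ ω, BRCMAB.regret T θ s a ω ∂P ≤
        3 * (4 * √Real.pi * Real.exp 1) ^ ((2 - α) / (1 - α)) / 2
          * √(d * Real.log (4 * (T : ℝ) ^ 2) * Real.log (2 * (T : ℝ) ^ 2 / (1 - α)))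
          * (15 * √(d * K * T * Real.log T) + 6 * √(2 * T * Real.log (2 * (T : ℝ) ^ 2)))) := by
  have hS : BRCMAB.IsSandwiched C := by
    rcases hC with rfl | rfl
    · exact BRCMAB.isSandwiched_modCVaR hα₀ hα₁
    · exact BRCMAB.isSandwiched_mcCVaR hα₀ hα₁
  obtain ⟨ω⟩ : Nonempty Ω := nonempty_of_isProbabilityMeasure P
  have : NeZero K := ⟨(a 0 ω).pos.ne'⟩
  exact ⟨fun δ hδ₀ hδ₁ h => h.le_prob_regret_le hQ hS hT hα₀ hα₁ hδ₀ hδ₁.le,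
    fun h => h.integral_regret_le hQ hS hT hα₀ hα₁⟩
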